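/- Write $(a)^+=\max\{a,0\}$, let $\log$ be the logarithm to base two, and let all bit vectors and matrices be over $\mathbb{Z}_2$. Fix $N=(n_{mk})_{m,k\in\{1,2\}}$ with $n_{mk}\in\{0,1,2,\dots\}$ and $\min\{n_{11},n_{22}\}\ge\max\{n_{12},n_{21}\}$, and gains $g=(g_{mk})\in(1,2]^{2\times 3}$, $m\in\{1,2\}$, $k\in\{0,1,2\}$. Let $[g_{mk}]_j$ be the binary digit of $g_{mk}$ of weight $2^{-j}$ (with $2=1.111\ldots$, so that $[g_{mk}]_0=1$), and let $\bar G_{mk}$ be the $n_{mm}\times n_{mm}$ lower-triangular Toeplitz matrix with ones on the diagonal and $[g_{mk}]_j$ on the $j$-th subdiagonal. The (modulated) lower-triangular deterministic X-channel has inputs $\bar u_{m1}\in\mathbb{Z}_2^{n_{11}}$ and $\bar u_{m2}\in\mathbb{Z}_2^{n_{22}}$, $m\in\{1,2\}$, where $\bar u_{mk}$ is sent by transmitter $k$ and carries its message for receiver $m$. Let $\bar u^{C}_{m1}$ be the first $n_{21}$ bits of $\bar u_{m1}$ and $\bar u^{C}_{m2}$ the first $n_{12}$ bits of $\bar u_{m2}$.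 The outputs at receivers one and two are $$\bar y_1=\bar G_{11}\bar u_{11}\oplus\bar G_{12}\begin{pmatrix}0\\ \bar u^{C}_{12}\end{pmatrix}\oplus\bar G_{10}\left(\bar u_{21}\oplus\begin{pmatrix}0\\ \bar u^{C}_{22}\end{pmatrix}\right)\in\mathbb{Z}_2^{n_{11}},$$ $$\bar y_2=\bar G_{22}\bar u_{22}\oplus\bar G_{21}\begin{pmatrix}0\\ \bar u^{C}_{21}\end{pmatrix}\oplus\bar G_{20}\left(\bar u_{12}\oplus\begin{pmatrix}0\\ \bar u^{C}_{11}\end{pmatrix}\right)\in\mathbb{Z}_2^{n_{22}}.$$ There are four independent, uniformly distributed messages $w_{mk}$, from transmitter $k$ to receiver $m$. In a block code of length $T$, each $w_{mk}$ is encoded separately into $(\bar u_{mk}[t])_{t=1}^T$, and receiver $m$ decodes $w_{m1}$ and $w_{m2}$ from $(\bar y_m[t])_{t=1}^T$. A tuple of nonnegative rates $(\bar R_{mk})$ is achievable if for every $\varepsilon>0$ and all sufficiently large $T$ there is such a code, which may depend on $g$, with at least $2^{T\bar R_{mk}}$ values for each $w_{mk}$ and probability at most $\varepsilon$ that some message is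 decoded incorrectly. The sum capacity $\bar C(N)=\bar C(N,g)$ is the supremum of $\bar R_{11}+\bar R_{12}+\bar R_{21}+\bar R_{22}$ over achievable tuples. **Theorem.** There is a universal constant $c_1>0$ such that for every $\delta\in(0,1]$ and every $N\in\{0,1,2,\dots\}^{2\times2}$ with $\min\{n_{11},n_{22}\}\ge\max\{n_{12},n_{21}\}$ there exists a measurable set $B\subseteq(1,2]^{2\times3}$ of Lebesgue measure $\mu(B)\le\delta$ such that for all $g\in(1,2]^{2\times3}\setminus B$ $$D(N)-2\log(c_1/\delta)\le\bar C(N)\le D(N),$$ where $$D(N)=\min\{D_1(N),D_2(N),D_3(N),D_4(N)\}+(n_{11}-n_{21})+(n_{22}-n_{12}),$$ $$D_1(N)=(n_{12}+n_{21}-n_{11})^++(n_{12}+n_{21}-n_{22})^+,$$ $$D_2(N)=\tfrac12\big(n_{12}+n_{21}+(n_{12}+n_{21}-n_{22})^+\big),$$ $$D_3(N)=\tfrac12\big(n_{12}+n_{21}+(n_{12}+n_{21}-n_{11})^+\big),$$ $$D_4(N)=\tfrac23(n_{12}+n_{21}).$$ -/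

import Mathlib

namespace XChannel

/-!
Indexing conventions.  Receivers `m ∈ {1, 2}` and transmitters `k ∈ {1, 2}` are indexed by `Fin 2`
(the value `0` stands for the first one, `1` for the second one).  The bit levels `n_{mk}` are
`N (m-1) (k-1)`.  The gains `g_{mk}`, with `m ∈ {1, 2}` and `k ∈ {0, 1, 2}`, are `g (m-1) k` with
`g : Fin 2 → Fin 3 → ℝ`; thus the second index of a gain is literally `k`.
Bit vectors of length `n` are functions `Fin n → ZMod 2`, the most significant bit first.
-/

/-- The box `(1, 2]^{2 × 3}` of channel gains. -/
def gainBox : Set (Fin 2 → Fin 3 → ℝ) :=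
  {g | ∀ m k, g m k ∈ Set.Ioc (1 : ℝ) 2}

/-- The bit `[g]_j` of weight `2^{-j}` in the binary expansion of `g ∈ (1, 2]`.  This is the usual
(terminating, for dyadic `g`) expansion, except that `2 = 1.111…`, so that `[g]_0 = 1` on all of
`(1, 2]`. -/
noncomputable def binDigit (g : ℝ) (j : ℕ) : ZMod 2 :=
  if g = 2 then 1 else ((⌊(2 : ℝ) ^ j * g⌋ : ℤ) : ZMod 2)

/-- The `n × n` lower-triangular Toeplitz matrix over `ℤ₂` with ones on the diagonal and the
digit `[g]_j` on the `j`-th subdiagonal. -/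
noncomputable def toeplitz (n : ℕ) (g : ℝ) : Matrix (Fin n) (Fin n) (ZMod 2) :=
  Matrix.of fun i j =>
    if j = i then 1 else if j < i then binDigit g ((i : ℕ) - (j : ℕ)) else 0

/-- The part of a signal `u` (of length `n_{kk}`) sent by transmitter `k` that is seen by
receiver `m`: the first `n_{mk}` bits of `u`, below `n_{mm} - n_{mk}` zeros.  For `k = m` this is
`u` itself; for `k ≠ m` it is the zero-padded common portion of `u`. -/
def seen (N : Fin 2 → Fin 2 → ℕ) (m k : Fin 2) (u : Fin (N k k) → ZMod 2) :
    Fin (N m m) → ZMod 2 := fun i =>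
  if h : N m m - N m k ≤ (i : ℕ) ∧ (i : ℕ) - (N m m - N m k) < N k k then
    u ⟨(i : ℕ) - (N m m - N m k), h.2⟩
  else 0

/-- The output at receiver `m` of the modulated lower-triangular deterministic X-channel, where
`u a k` is the signal sent by transmitter `k` and carrying its message for receiver `a`.  The
desired signals `u m k` are multiplied by `G_{m1}` and `G_{m2}`; both signals intended for the other
receiver `m.rev` are multiplied by the same matrix `G_{m0}`. -/
noncomputable def output (N : Fin 2 → Fin 2 → ℕ) (g : Fin 2 → Fin 3 → ℝ)
    (u : (a k : Fin 2) → Fin (N k k) → ZMod 2) (m : Fin 2) : Fin (N m m) → ZMod 2 :=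
  (toeplitz (N m m) (g m 1)).mulVec (seen N m 0 (u m 0))
    + (toeplitz (N m m) (g m 2)).mulVec (seen N m 1 (u m 1))
    + (toeplitz (N m m) (g m 0)).mulVec (seen N m 0 (u m.rev 0) + seen N m 1 (u m.rev 1))

/-- A block code of length `T`; the message `w_{mk}` from transmitter `k` to receiver `m` takes
`M m k` values.  Each of the four messages has its own encoder. -/
structure Code (N : Fin 2 → Fin 2 → ℕ) (T : ℕ) (M : Fin 2 → Fin 2 → ℕ) where
  /-- encoder at transmitter `k` of the message for receiver `m` -/
  enc : (m k : Fin 2) → Fin (M m k) → Fin T → Fin (N k k) → ZMod 2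
  /-- decoder at receiver `m` of the message from transmitter `k` -/
  dec : (m k : Fin 2) → (Fin T → Fin (N m m) → ZMod 2) → Fin (M m k)

/-- The outputs at receiver `m` in the `T` channel uses when the messages `w` are sent. -/
noncomputable def Code.received {N : Fin 2 → Fin 2 → ℕ} {T : ℕ} {M : Fin 2 → Fin 2 → ℕ}
    (c : Code N T M) (g : Fin 2 → Fin 3 → ℝ) (w : (m k : Fin 2) → Fin (M m k)) (m : Fin 2) :
    Fin T → Fin (N m m) → ZMod 2 :=
  fun t => output N g (fun a k => c.enc a k (w a k) t) m

/-- The probability that some desired message is decoded incorrectly, when the four messages are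
independent and uniformly distributed. -/
noncomputable def Code.errorProb {N : Fin 2 → Fin 2 → ℕ} {T : ℕ} {M : Fin 2 → Fin 2 → ℕ}
    (c : Code N T M) (g : Fin 2 → Fin 3 → ℝ) : ℝ :=
  ({w : (m k : Fin 2) → Fin (M m k) | ∃ m k, c.dec m k (c.received g w m) ≠ w m k}.ncard : ℝ)
    / (Nat.card ((m k : Fin 2) → Fin (M m k)) : ℝ)

/-- The rate tuple `R` (in bits per channel use) is achievable: for every `ε > 0` and all large
enough block lengths `T` there is a code with at least `2 ^ (T R_{mk})` values for each message
`w_{mk}` and with error probability at most `ε`. -/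
def Achievable (N : Fin 2 → Fin 2 → ℕ) (g : Fin 2 → Fin 3 → ℝ) (R : Fin 2 → Fin 2 → ℝ) : Prop :=
  (∀ m k, 0 ≤ R m k) ∧
    ∀ ε : ℝ, 0 < ε → ∃ T₀ : ℕ, ∀ T : ℕ, T₀ ≤ T →
      ∃ (M : Fin 2 → Fin 2 → ℕ) (c : Code N T M),
        (∀ m k, (2 : ℝ) ^ ((T : ℝ) * R m k) ≤ (M m k : ℝ)) ∧ c.errorProb g ≤ ε

/-- The sum capacity: the supremum, in the extended reals, of `R₁₁ + R₁₂ + R₂₁ + R₂₂` over all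
achievable rate tuples. -/
noncomputable def sumCapacity (N : Fin 2 → Fin 2 → ℕ) (g : Fin 2 → Fin 3 → ℝ) : EReal :=
  sSup ((fun R : Fin 2 → Fin 2 → ℝ => ((∑ m, ∑ k, R m k : ℝ) : EReal)) '' {R | Achievable N g R})

/-- `D₁(N) = (n₁₂ + n₂₁ - n₁₁)⁺ + (n₁₂ + n₂₁ - n₂₂)⁺` -/
noncomputable def D1 (N : Fin 2 → Fin 2 → ℕ) : ℝ :=
  max ((N 0 1 : ℝ) + N 1 0 - N 0 0) 0 + max ((N 0 1 : ℝ) + N 1 0 - N 1 1) 0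

/-- `D₂(N) = (n₁₂ + n₂₁ + (n₁₂ + n₂₁ - n₂₂)⁺) / 2` -/
noncomputable def D2 (N : Fin 2 → Fin 2 → ℕ) : ℝ :=
  (1 / 2 : ℝ) * ((N 0 1 : ℝ) + N 1 0 + max ((N 0 1 : ℝ) + N 1 0 - N 1 1) 0)

/-- `D₃(N) = (n₁₂ + n₂₁ + (n₁₂ + n₂₁ - n₁₁)⁺) / 2` -/
noncomputable def D3 (N : Fin 2 → Fin 2 → ℕ) : ℝ :=
  (1 / 2 : ℝ) * ((N 0 1 : ℝ) + N 1 0 + max ((N 0 1 : ℝ) + N 1 0 - N 0 0) 0)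

/-- `D₄(N) = 2 (n₁₂ + n₂₁) / 3` -/
noncomputable def D4 (N : Fin 2 → Fin 2 → ℕ) : ℝ :=
  (2 / 3 : ℝ) * ((N 0 1 : ℝ) + N 1 0)

/-- `D(N) = min {D₁, D₂, D₃, D₄} + (n₁₁ - n₂₁) + (n₂₂ - n₁₂)` -/
noncomputable def D (N : Fin 2 → Fin 2 → ℕ) : ℝ :=
  min (min (D1 N) (D2 N)) (min (D3 N) (D4 N))
    + ((N 0 0 : ℝ) - N 1 0) + ((N 1 1 : ℝ) - N 0 1)

end XChannel

/-! Converse, valid for every gain. Fano's inequality and independence bound the rate towards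
receiver `m` by the entropy of its output minus that of its interference, up to vanishing terms
(`Code.log_card_le`). The interference is a single vector, since both undesired signals pass through
the same matrix. Unit lower-triangular matrices are invertible and act from the top level down, so
the entropy comparisons do not depend on the gains. Outputs are bounded above and interference below
by entropies of truncated signals, and four linear combinations of these bounds give D₁, …, D₄
(`Code.entropy_sub_le`).

Achievability, outside a small set of gains. Uncoded bits are sent on chosen levels, so placed that
the two undesired signals overlap at each receiver. A receiver then sees three bit patterns (two
desired, one interfering), each multiplied by the digit series of a gain in ℤ₂⟦X⟧. Confusion
requires a nonzero triple of patterns whose combination vanishes in the first `n` coefficients. The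
first level ν of such a triple is shared by two patterns, and the vanishing then pins down n - 1 - ν
free digits of one gain, given the digits of the others. A union bound over triples starting at ν
succeeds once the bits from ν on number at least `K` fewer than the n - ν remaining levels
(`volume_not_resolvable_le`).

What remains is integer programming: the counting conditions become the inequalities `Fits` on the
lengths of the bit blocks, and `exists_lengths` solves them up to a guard of `K` levels per receiver
and rounding. Taking `K` about log(24/δ) gives the stated loss. -/

namespace XChannel

/-! ### Entropy on a finite uniform space: Gibbs, submodularity, Fano, independence -/

section Entropy

open Classical in
/-- The number of points at which `f` takes the same value as at `ω`. -/
noncomputable def fiberCard {Ω α : Type*} [Fintype Ω] (f : Ω → α) (ω : Ω) : ℕ :=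
  (Finset.univ.filter fun ω' => f ω' = f ω).card

/-- The Shannon entropy, in nats, of the random variable `f` on the uniform probability space
`Ω`. -/
noncomputable def entropy {Ω α : Type*} [Fintype Ω] (f : Ω → α) : ℝ :=
  (∑ ω, Real.log ((Fintype.card Ω : ℝ) / fiberCard f ω)) / Fintype.card Ω

variable {Ω α β γ : Type*} [Fintype Ω]

theorem fiberCard_pos (f : Ω → α) (ω : Ω) : 0 < fiberCard f ω := by
  classical
  exact Finset.card_pos.2 ⟨ω, by simp⟩

theorem card_pos_of_mem (ω : Ω) : (0 : ℝ) < Fintype.card Ω := by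
  exact_mod_cast Fintype.card_pos_iff.2 ⟨ω⟩

theorem entropy_mono {f : Ω → α} {h : Ω → β} (H : ∀ ω ω', f ω = f ω' → h ω = h ω') :
    entropy h ≤ entropy f := by
  classical
  unfold entropy
  refine div_le_div_of_nonneg_right (Finset.sum_le_sum fun ω _ => ?_) (Nat.cast_nonneg _)
  have h1 : (0 : ℝ) < fiberCard f ω := by exact_mod_cast fiberCard_pos f ω
  have h2 : (fiberCard f ω : ℝ) ≤ fiberCard h ω := by
    unfold fiberCard
    exact_mod_cast Finset.card_le_card (Finset.monotone_filter_right _ fun ω' _ hw => H _ _ hw)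
  have h3 := card_pos_of_mem ω
  exact Real.log_le_log (div_pos h3 (h1.trans_le h2)) (div_le_div_of_nonneg_left h3.le h1 h2)

/-- Gibbs' inequality for a conditional sub-distribution `q`. -/
theorem entropy_pair_le [Fintype α] [Fintype β] (f : Ω → α) (h : Ω → β) (q : α → β → ℝ)
    (q_nonneg : ∀ a b, 0 ≤ q a b) (q_pos : ∀ ω, 0 < q (f ω) (h ω)) (q_sum : ∀ b, ∑ a, q a b ≤ 1) :
    entropy (fun ω => (f ω, h ω)) ≤
      entropy h + (∑ ω, -Real.log (q (f ω) (h ω))) / Fintype.card Ω := by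
  classical
  unfold entropy
  rw [← add_div, ← Finset.sum_add_distrib]
  refine div_le_div_of_nonneg_right ?_ (Nat.cast_nonneg _)
  rw [← sub_nonpos, ← Finset.sum_sub_distrib]
  -- This is log x ≤ x - 1; summed over Ω, grouping by the values of (f, h), the quantity x
  -- contributes at most ∑ q(a|b) c(b) ≤ |Ω|.
  have key : ∀ ω, Real.log ((Fintype.card Ω : ℝ) / fiberCard (fun ω => (f ω, h ω)) ω) -
      (Real.log ((Fintype.card Ω : ℝ) / fiberCard h ω) + -Real.log (q (f ω) (h ω))) ≤
      q (f ω) (h ω) * fiberCard h ω / fiberCard (fun ω => (f ω, h ω)) ω - 1 := by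
    intro ω
    have h1 : (0 : ℝ) < fiberCard (fun ω => (f ω, h ω)) ω := by exact_mod_cast fiberCard_pos _ ω
    have h2 : (0 : ℝ) < fiberCard h ω := by exact_mod_cast fiberCard_pos _ ω
    have h3 := card_pos_of_mem ω
    have h4 := q_pos ω
    have := Real.log_le_sub_one_of_pos (x := q (f ω) (h ω) * fiberCard h ω /
      fiberCard (fun ω => (f ω, h ω)) ω) (by positivity)
    rw [Real.log_div (by positivity) h1.ne', Real.log_mul h4.ne' h2.ne'] at this
    rw [Real.log_div h3.ne' h1.ne', Real.log_div h3.ne' h2.ne']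
    linarith
  refine (Finset.sum_le_sum fun ω _ => key ω).trans ?_
  rw [Finset.sum_sub_distrib, sub_nonpos]
  let c : β → ℕ := fun b => (Finset.univ.filter fun ω => h ω = b).card
  let d : α × β → ℕ := fun x => (Finset.univ.filter fun ω => (f ω, h ω) = x).card
  have e1 : ∑ ω, q (f ω) (h ω) * fiberCard h ω / fiberCard (fun ω => (f ω, h ω)) ω =
      ∑ ω, (fun x : α × β => q x.1 x.2 * c x.2 / d x) (f ω, h ω) := by
    refine Finset.sum_congr rfl fun ω _ => ?_
    simp [fiberCard, c, d]
  have e2 : (∑ ω : Ω, (1 : ℝ)) = ∑ b, (c b : ℝ) := by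
    have := Finset.card_eq_sum_card_fiberwise (f := h) (s := Finset.univ) (t := Finset.univ)
      (fun _ _ => by simp)
    simp only [Finset.sum_const, nsmul_eq_mul, mul_one]
    rw [this]; push_cast; rfl
  rw [e1, e2, Finset.sum_comp (fun x : α × β => q x.1 x.2 * c x.2 / d x) (fun ω => (f ω, h ω))]
  calc _ ≤ ∑ x ∈ Finset.univ.image (fun ω => (f ω, h ω)), q x.1 x.2 * c x.2 := by
        refine Finset.sum_le_sum fun x _ => ?_
        rw [nsmul_eq_mul]
        by_cases hd : d x = 0
        · have h0 : 0 ≤ q x.1 x.2 * c x.2 := mul_nonneg (q_nonneg _ _) (Nat.cast_nonneg _)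
          have : ((Finset.univ.filter fun ω => (f ω, h ω) = x).card : ℝ) = 0 := by
            exact_mod_cast hd
          rw [this, zero_mul]; exact h0
        · have : ((Finset.univ.filter fun ω => (f ω, h ω) = x).card : ℝ) = d x := rfl
          rw [this, mul_div_cancel₀]
          exact_mod_cast hd
    _ ≤ ∑ x : α × β, q x.1 x.2 * c x.2 :=
        Finset.sum_le_sum_of_subset_of_nonneg (Finset.subset_univ _)
          fun x _ _ => mul_nonneg (q_nonneg _ _) (Nat.cast_nonneg _)
    _ = ∑ b, (∑ a, q a b) * c b := by
        rw [Fintype.sum_prod_type_right]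
        simp [Finset.sum_mul]
    _ ≤ ∑ b, (c b : ℝ) := Finset.sum_le_sum fun b _ =>
        mul_le_of_le_one_left (Nat.cast_nonneg _) (q_sum b)

theorem entropy_pair_le_add_log_card [Nonempty Ω] [Fintype α] [Fintype β] [Nonempty α] (f : Ω → α)
    (h : Ω → β) :
    entropy (fun ω => (f ω, h ω)) ≤ entropy h + Real.log (Fintype.card α) := by
  have hc : (0 : ℝ) < Fintype.card α := by exact_mod_cast Fintype.card_pos
  have hΩ : (0 : ℝ) < Fintype.card Ω := by exact_mod_cast Fintype.card_pos
  refine (entropy_pair_le f h (fun _ _ => (Fintype.card α : ℝ)⁻¹) (fun _ _ => by positivity)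
    (fun _ => by positivity) fun _ => ?_).trans_eq ?_
  · simp [hc.ne']
  · simp [Real.log_inv, mul_div_cancel_left₀, hΩ.ne']

/-- Further conditioning on `g` cannot increase the conditional entropy of `f` given `h`: apply
Gibbs with the empirical law of `f` given `h`, which ignores `g`. -/
theorem entropy_submodular [Fintype α] [Fintype β] [Fintype γ]
    (f : Ω → α) (g : Ω → β) (h : Ω → γ) :
    entropy (fun ω => (f ω, g ω, h ω)) + entropy h ≤
      entropy (fun ω => (f ω, h ω)) + entropy (fun ω => (g ω, h ω)) := by
  classical
  let c : γ → ℕ := fun b => (Finset.univ.filter fun ω => h ω = b).card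
  let d : α → γ → ℕ := fun a b => (Finset.univ.filter fun ω => (f ω, h ω) = (a, b)).card
  have hd : ∀ ω, d (f ω) (h ω) = fiberCard (fun ω => (f ω, h ω)) ω := fun ω => by
    simp [d, fiberCard]
  have hc : ∀ ω, c (h ω) = fiberCard h ω := fun ω => by simp [c, fiberCard]
  have key := entropy_pair_le f (fun ω => (g ω, h ω)) (fun a b => (d a b.2 : ℝ) / c b.2)
    (fun _ _ => by positivity)
    (fun ω => by
      have h1 := fiberCard_pos (fun ω => (f ω, h ω)) ω
      have h2 := fiberCard_pos h ω
      simp only [hd, hc]; positivity)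
    (fun b => by
      rw [← Finset.sum_div]
      refine div_le_one_of_le₀ ?_ (Nat.cast_nonneg _)
      have := Finset.card_eq_sum_card_fiberwise (f := f)
        (s := Finset.univ.filter fun ω => h ω = b.2) (t := Finset.univ) (fun _ _ => by simp)
      have e : c b.2 = ∑ a, d a b.2 := by
        simp only [c, d]
        rw [this]
        refine Finset.sum_congr rfl fun a _ => ?_
        congr 1
        ext ω
        simp [and_comm]
      rw [e]; push_cast; rfl)
  have e : (∑ ω, -Real.log ((d (f ω) (h ω) : ℝ) / c (h ω))) / Fintype.card Ω =
      entropy (fun ω => (f ω, h ω)) - entropy h := by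
    unfold entropy
    rw [← sub_div, ← Finset.sum_sub_distrib]
    congr 1
    refine Finset.sum_congr rfl fun ω _ => ?_
    have h1 : (0 : ℝ) < fiberCard (fun ω => (f ω, h ω)) ω := by exact_mod_cast fiberCard_pos _ ω
    have h2 : (0 : ℝ) < fiberCard h ω := by exact_mod_cast fiberCard_pos _ ω
    have h3 := card_pos_of_mem ω
    rw [hd, hc, Real.log_div h3.ne' h1.ne', Real.log_div h3.ne' h2.ne', Real.log_div h1.ne' h2.ne']
    ring
  simp only at key
  rw [e] at key
  linarith

theorem entropy_const (c : α) : entropy (fun _ : Ω => c) = 0 := by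
  simp only [entropy, fiberCard]
  by_cases h : (Fintype.card Ω : ℝ) = 0
  · simp [h]
  · simp [h]

theorem entropy_nonneg (f : Ω → α) : 0 ≤ entropy f := by
  rw [← entropy_const (Ω := Ω) ()]
  exact entropy_mono fun _ _ _ => rfl

theorem entropy_pair_le_add [Fintype α] [Fintype β] (f : Ω → α) (g : Ω → β) :
    entropy (fun ω => (f ω, g ω)) ≤ entropy f + entropy g := by
  have h1 := entropy_submodular f g (fun _ => ())
  have h2 := entropy_const (Ω := Ω) ()
  have h3 : entropy (fun ω => (f ω, g ω)) ≤ entropy (fun ω => (f ω, g ω, ())) :=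
    entropy_mono fun ω ω' h => by simpa using h
  have h4 : entropy (fun ω => (f ω, ())) ≤ entropy f := entropy_mono fun ω ω' h => by simpa using h
  have h5 : entropy (fun ω => (g ω, ())) ≤ entropy g := entropy_mono fun ω ω' h => by simpa using h
  linarith

theorem fano [Nonempty Ω] [Fintype α] [Fintype β] (W : Ω → α) (y : Ω → β) (dec : β → α) {ε : ℝ}
    (hε : ({ω | dec (y ω) ≠ W ω}.ncard : ℝ) ≤ ε * Fintype.card Ω) :
    entropy (fun ω => (W ω, y ω)) ≤
      entropy y + Real.log 2 + ε * Real.log (Fintype.card α) := by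
  classical
  obtain ⟨ω₀⟩ := ‹Nonempty Ω›
  have hα : (0 : ℝ) < Fintype.card α := by exact_mod_cast Fintype.card_pos_iff.2 ⟨W ω₀⟩
  have hα1 : (1 : ℝ) ≤ Fintype.card α := by
    exact_mod_cast Nat.one_le_iff_ne_zero.2 (Fintype.card_pos_iff.2 ⟨W ω₀⟩).ne'
  have hΩ := card_pos_of_mem ω₀
  -- Half the mass goes to the decoder's guess and half is uniform, so a correct guess costs at most
  -- log 2 and a wrong one log 2 + log |α|.
  have key := entropy_pair_le W y
    (fun a b => (if dec b = a then 1 / 2 else 0) + 1 / (2 * (Fintype.card α : ℝ)))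
    (fun a b => by positivity) (fun ω => by positivity)
    (fun b => by
      rw [Finset.sum_add_distrib]
      simp only [Finset.sum_ite_eq, Finset.mem_univ, if_true, Finset.sum_const, nsmul_eq_mul,
        Finset.card_univ]
      field_simp
      norm_num)
  refine key.trans ?_
  rw [add_assoc]
  gcongr
  rw [div_le_iff₀ hΩ]
  have hb : ∀ ω, -Real.log ((if dec (y ω) = W ω then (1 : ℝ) / 2 else 0) +
      1 / (2 * (Fintype.card α : ℝ))) ≤
      Real.log 2 + (if dec (y ω) ≠ W ω then 1 else 0) * Real.log (Fintype.card α) := by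
    intro ω
    rw [← Real.log_inv]
    split_ifs with h1 h2
    · exact absurd h1 h2
    · rw [zero_mul, add_zero]
      refine Real.log_le_log (by positivity) ?_
      rw [inv_le_comm₀ (by positivity) (by positivity)]
      have : 0 < 1 / (2 * (Fintype.card α : ℝ)) := by positivity
      linarith
    · rw [one_mul, ← Real.log_mul (by norm_num) hα.ne']
      exact Real.log_le_log (by positivity) (by simp)
  refine (Finset.sum_le_sum fun ω _ => hb ω).trans ?_
  rw [Finset.sum_add_distrib, ← Finset.sum_mul]
  simp only [Finset.sum_const, nsmul_eq_mul, Finset.card_univ]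
  have e : (∑ ω, if dec (y ω) ≠ W ω then (1 : ℝ) else 0) = ({ω | dec (y ω) ≠ W ω}.ncard : ℝ) := by
    rw [Finset.sum_boole, Set.ncard_eq_toFinset_card']
    simp
  rw [e]
  have := mul_le_mul_of_nonneg_right hε (Real.log_nonneg hα1)
  linarith

/-- Independence: `f` and `g` are independent if the points of `Ω` can be recombined by `m`, so that
`f` only sees the first and `g` only the second argument. -/
theorem entropy_pair_of_mix (m : Ω → Ω → Ω) (f : Ω → α) (g : Ω → β)
    (m1 : ∀ x y, m (m x y) (m y x) = x) (f1 : ∀ x y, f (m x y) = f x)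
    (g1 : ∀ x y, g (m x y) = g y) :
    entropy (fun ω => (f ω, g ω)) = entropy f + entropy g := by
  classical
  have key : ∀ ω, fiberCard (fun ω => (f ω, g ω)) ω * Fintype.card Ω =
      fiberCard f ω * fiberCard g ω := by
    intro ω
    unfold fiberCard
    rw [← Finset.card_univ, ← Finset.card_product, ← Finset.card_product]
    -- The involution (x, y) ↦ (m x y, m y x) of Ω × Ω carries (joint fiber) × Ω onto the product of
    -- the two fibers.
    refine Finset.card_bij' (fun x _ => (m x.1 x.2, m x.2 x.1)) (fun x _ => (m x.1 x.2, m x.2 x.1))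
      ?_ ?_ ?_ ?_
    · rintro ⟨x, y⟩ h
      simp only [Finset.mem_product, Finset.mem_filter, Finset.mem_univ, true_and,
        Prod.mk.injEq] at h ⊢
      simp [f1, g1, h.1]
    · rintro ⟨x, y⟩ h
      simp only [Finset.mem_product, Finset.mem_filter, Finset.mem_univ, true_and,
        Prod.mk.injEq] at h ⊢
      simp [f1, g1, h.1, h.2]
    · rintro ⟨x, y⟩ _
      simp [m1]
    · rintro ⟨x, y⟩ _
      simp [m1]
  unfold entropy
  rw [← add_div, ← Finset.sum_add_distrib]
  congr 1
  refine Finset.sum_congr rfl fun ω _ => ?_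
  have h1 : (0 : ℝ) < fiberCard (fun ω => (f ω, g ω)) ω := by exact_mod_cast fiberCard_pos _ ω
  have h2 : (0 : ℝ) < fiberCard f ω := by exact_mod_cast fiberCard_pos _ ω
  have h3 : (0 : ℝ) < fiberCard g ω := by exact_mod_cast fiberCard_pos _ ω
  have h4 := card_pos_of_mem ω
  rw [← Real.log_mul (by positivity) (by positivity)]
  congr 1
  have : (fiberCard (fun ω => (f ω, g ω)) ω : ℝ) * Fintype.card Ω =
    fiberCard f ω * fiberCard g ω := by exact_mod_cast key ω
  field_simp
  linarith

theorem entropy_id [Nonempty Ω] : entropy (fun ω : Ω => ω) = Real.log (Fintype.card Ω) := by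
  have h2 : (0 : ℝ) < Fintype.card Ω := by exact_mod_cast Fintype.card_pos
  have h1 : ∀ ω : Ω, fiberCard (fun ω => ω) ω = 1 := fun ω =>
    Finset.card_eq_one.2 ⟨ω, by ext; simp⟩
  simp [entropy, h1, mul_div_cancel_left₀, h2.ne']

end Entropy

/-! ### Entropy inequalities for codes on the channel -/

section Converse

theorem toeplitz_mulVec_congr {n : ℕ} (x : ℝ) {v v' : Fin n → ZMod 2} {j : ℕ}
    (h : ∀ i : Fin n, (i : ℕ) < j → v i = v' i) (i : Fin n) (hi : (i : ℕ) < j) :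
    (toeplitz n x).mulVec v i = (toeplitz n x).mulVec v' i := by
  simp only [Matrix.mulVec, dotProduct]
  refine Finset.sum_congr rfl fun k _ => ?_
  by_cases hk : k ≤ i
  · rw [h k (lt_of_le_of_lt hk hi)]
  · have h1 : k ≠ i := fun h => hk h.le
    have h2 : ¬ k < i := fun h => hk h.le
    simp [toeplitz, h1, h2]

theorem toeplitz_mulVec_apply {n : ℕ} (x : ℝ) (v : Fin n → ZMod 2) (i : Fin n) :
    (toeplitz n x).mulVec v i =
      v i + ∑ k, if k < i then binDigit x ((i : ℕ) - k) * v k else 0 := by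
  simp only [Matrix.mulVec, dotProduct]
  have : v i = ∑ k, if k = i then v k else 0 := by simp
  rw [this, ← Finset.sum_add_distrib]
  refine Finset.sum_congr rfl fun k _ => ?_
  rcases lt_trichotomy k i with h | h | h
  · simp [toeplitz, h.ne, h]
  · simp [toeplitz, h]
  · simp [toeplitz, h.ne', h.not_gt]

/-- Forward substitution: the diagonal is one, so the top `j` output bits determine the top `j`
input bits. -/
theorem eq_of_toeplitz_mulVec_eq {n : ℕ} (x : ℝ) {v v' : Fin n → ZMod 2} {j : ℕ}
    (h : ∀ i : Fin n, (i : ℕ) < j → (toeplitz n x).mulVec v i = (toeplitz n x).mulVec v' i)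
    (i : Fin n) (hi : (i : ℕ) < j) : v i = v' i := by
  induction i using WellFoundedLT.induction with
  | _ i ih =>
    have h1 := h i hi
    rw [toeplitz_mulVec_apply, toeplitz_mulVec_apply] at h1
    have : (∑ k, if k < i then binDigit x ((i : ℕ) - k) * v k else 0) =
        ∑ k, if k < i then binDigit x ((i : ℕ) - k) * v' k else 0 := by
      refine Finset.sum_congr rfl fun k _ => ?_
      split_ifs with hk
      · rw [ih k hk (lt_trans hk hi)]
      · rfl
    rw [this] at h1
    exact add_right_cancel h1

variable {N : Fin 2 → Fin 2 → ℕ}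

theorem seen_self (m : Fin 2) (u : Fin (N m m) → ZMod 2) : seen N m m u = u := by
  funext i
  simp [seen]

theorem seen_eq_zero {m k : Fin 2} (u : Fin (N k k) → ZMod 2) (i : Fin (N m m))
    (hi : (i : ℕ) < N m m - N m k) : seen N m k u i = 0 := by
  simp [seen, hi.not_ge]

theorem seen_congr {m k : Fin 2} (hN : N m k ≤ N m m) {u u' : Fin (N k k) → ZMod 2}
    (h : ∀ i : Fin (N k k), (i : ℕ) < N m k → u i = u' i) : seen N m k u = seen N m k u' := by
  funext i
  unfold seen
  split_ifs with hi
  · refine h _ ?_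
    have := i.2
    simp only
    omega
  · rfl

theorem eq_of_seen_eq {m k : Fin 2} (hN : N m k ≤ N m m) {u u' : Fin (N k k) → ZMod 2}
    (h : seen N m k u = seen N m k u') (i : Fin (N k k)) (hi : (i : ℕ) < N m k) : u i = u' i := by
  have h1 := congrFun h ⟨N m m - N m k + i, by omega⟩
  have h2 : N m m - N m k + (i : ℕ) - (N m m - N m k) = i := by omega
  have h3 : ∀ v : Fin (N k k) → ZMod 2, seen N m k v ⟨N m m - N m k + i, by omega⟩ = v i := by
    intro v
    simp [seen, h2]
  rwa [h3, h3] at h1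

theorem output_eq (g : Fin 2 → Fin 3 → ℝ) (u : (a k : Fin 2) → Fin (N k k) → ZMod 2) (m : Fin 2) :
    output N g u m = (toeplitz (N m m) (g m m.succ)).mulVec (u m m)
      + (toeplitz (N m m) (g m m.rev.succ)).mulVec (seen N m m.rev (u m m.rev))
      + (toeplitz (N m m) (g m 0)).mulVec (u m.rev m + seen N m m.rev (u m.rev m.rev)) := by
  fin_cases m
  · have h := seen_self (N := N) 0
    simp [output, h]
  · have h := seen_self (N := N) 1
    simp only [output, h, Fin.mk_one, Fin.rev, Fin.isValue]
    rw [add_comm ((toeplitz (N 1 1) (g 1 1)).mulVec _)]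
    rw [add_comm (seen N 1 0 _)]
    rfl

/-- The first `j` bits of each of `T` blocks, followed by zeros. -/
def top {T n : ℕ} (j : ℕ) (x : Fin T → Fin n → ZMod 2) : Fin T → Fin n → ZMod 2 :=
  fun t i => if (i : ℕ) < j then x t i else 0

theorem top_eq_top_iff {T n j : ℕ} {x x' : Fin T → Fin n → ZMod 2} :
    top j x = top j x' ↔ ∀ t, ∀ i : Fin n, (i : ℕ) < j → x t i = x' t i := by
  constructor
  · intro h t i hi
    have := congrFun (congrFun h t) i
    simpa [top, hi] using this
  · intro h
    funext t i
    by_cases hi : (i : ℕ) < j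
    · simp [top, hi, h t i hi]
    · simp [top, hi]

namespace Code

variable {T : ℕ} {M : Fin 2 → Fin 2 → ℕ} (c : Code N T M) (g : Fin 2 → Fin 3 → ℝ)

/-- The signal sent by transmitter `k` that carries its message for receiver `a`. -/
def signal (a k : Fin 2) (w : (m k : Fin 2) → Fin (M m k)) : Fin T → Fin (N k k) → ZMod 2 :=
  c.enc a k (w a k)

/-- The aligned interference observed by receiver `m`. -/
noncomputable def interference (m : Fin 2) (w : (m k : Fin 2) → Fin (M m k)) :
    Fin T → Fin (N m m) → ZMod 2 :=
  fun t => (toeplitz (N m m) (g m 0)).mulVec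
    (c.signal m.rev m w t + seen N m m.rev (c.signal m.rev m.rev w t))

/-- The outputs at receiver `m`. -/
noncomputable def outputs (m : Fin 2) (w : (m k : Fin 2) → Fin (M m k)) :
    Fin T → Fin (N m m) → ZMod 2 :=
  c.received g w m

theorem outputs_apply (m : Fin 2) (w : (m k : Fin 2) → Fin (M m k)) (t : Fin T)
    (i : Fin (N m m)) :
    c.outputs g m w t i = (toeplitz (N m m) (g m m.succ)).mulVec (c.signal m m w t) i
      + (toeplitz (N m m) (g m m.rev.succ)).mulVec (seen N m m.rev (c.signal m m.rev w t)) i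
      + c.interference g m w t i := by
  simp only [outputs, received, output_eq]
  rfl

variable {c g}

theorem interference_eq_iff {m : Fin 2} {w w' : (m k : Fin 2) → Fin (M m k)} :
    c.interference g m w = c.interference g m w' ↔
      ∀ t, c.signal m.rev m w t + seen N m m.rev (c.signal m.rev m.rev w t) =
        c.signal m.rev m w' t + seen N m m.rev (c.signal m.rev m.rev w' t) := by
  constructor
  · intro h t
    funext i
    exact eq_of_toeplitz_mulVec_eq (g m 0) (j := N m m)
      (fun i _ => congrFun (congrFun h t) i) i i.2
  · intro h
    funext t
    simp only [interference, h t]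

variable (c g)

/-- Recombination of two message tuples. -/
def mix (A : Fin 2 → Fin 2 → Bool) (x y : (m k : Fin 2) → Fin (M m k)) :
    (m k : Fin 2) → Fin (M m k) :=
  fun m k => if A m k then x m k else y m k

theorem mix_mix (A : Fin 2 → Fin 2 → Bool) (x y : (m k : Fin 2) → Fin (M m k)) :
    mix A (mix A x y) (mix A y x) = x := by
  funext m k
  by_cases h : A m k <;> simp [mix, h]

theorem entropy_signal_pair {a k a' k' : Fin 2} (h : ¬ (a' = a ∧ k' = k)) {α β : Type*}
    (F : (Fin T → Fin (N k k) → ZMod 2) → α) (F' : (Fin T → Fin (N k' k') → ZMod 2) → β) :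
    entropy (fun w => (F (c.signal a k w), F' (c.signal a' k' w))) =
      entropy (fun w => F (c.signal a k w)) + entropy (fun w => F' (c.signal a' k' w)) := by
  refine entropy_pair_of_mix (mix fun i j => decide (i = a ∧ j = k)) _ _ (mix_mix _)
    (fun x y => ?_) (fun x y => ?_)
  · simp [signal, mix]
  · simp [signal, mix, h]

/-- The top `j` levels of the interference lie above the shifted far signal and so reveal the near
signal there. Given the whole near signal, the interference also reveals the visible part of the far
one. Submodularity combines the two facts, and independence splits the joint entropy. -/
theorem le_entropy_interference {m : Fin 2} (hN : N m m.rev ≤ N m m) {j : ℕ}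
    (hj : j ≤ N m m - N m m.rev) :
    entropy (fun w => top j (c.signal m.rev m w)) +
      entropy (fun w => top (N m m.rev) (c.signal m.rev m.rev w)) ≤
      entropy (c.interference g m) := by
  have h1 := entropy_submodular (c.interference g m) (c.signal m.rev m)
    (fun w => top j (c.signal m.rev m w))
  have h2 := c.entropy_signal_pair (a := m.rev) (k := m) (a' := m.rev) (k' := m.rev)
    (fun h => by fin_cases m <;> simp at h) (fun x => x) (top (N m m.rev))
  have h3 : entropy (fun w => (c.interference g m w, top j (c.signal m.rev m w))) ≤
      entropy (c.interference g m) := entropy_mono fun w w' h => by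
    refine Prod.ext h (top_eq_top_iff.2 fun t i hi => ?_)
    have h' := congrFun (interference_eq_iff.1 h t) i
    simp only [Pi.add_apply] at h'
    rwa [seen_eq_zero _ i (by omega), seen_eq_zero _ i (by omega), add_zero, add_zero] at h'
  have h4 : entropy (fun w => (c.signal m.rev m w, top j (c.signal m.rev m w))) ≤
      entropy (c.signal m.rev m) := entropy_mono fun w w' h => by simp [h]
  have h5 : entropy (fun w => (c.signal m.rev m w, top (N m m.rev) (c.signal m.rev m.rev w))) ≤
      entropy (fun w => (c.interference g m w, c.signal m.rev m w,
        top j (c.signal m.rev m w))) := entropy_mono fun w w' h => by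
    simp only [Prod.mk.injEq] at h ⊢
    refine ⟨h.2.1, top_eq_top_iff.2 fun t => eq_of_seen_eq hN ?_⟩
    have h' := interference_eq_iff.1 h.1 t
    rw [h.2.1] at h'
    exact add_left_cancel h'
  linarith

theorem entropy_signal_le_interference (m : Fin 2) :
    entropy (c.signal m.rev m) ≤ entropy (c.interference g m) := by
  have h1 := entropy_pair_le_add (c.interference g m) (c.signal m.rev m.rev)
  have h2 := c.entropy_signal_pair (a := m.rev) (k := m) (a' := m.rev) (k' := m.rev)
    (fun h => by fin_cases m <;> simp at h) (fun x => x) (fun x => x)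
  have h3 : entropy (fun w => (c.signal m.rev m w, c.signal m.rev m.rev w)) ≤
      entropy (fun w => (c.interference g m w, c.signal m.rev m.rev w)) :=
    entropy_mono fun w w' h => by
      simp only [Prod.mk.injEq] at h ⊢
      refine ⟨funext fun t => ?_, h.2⟩
      have h' := interference_eq_iff.1 h.1 t
      rw [h.2] at h'
      exact add_right_cancel h'
  linarith

theorem entropy_top_signal_le (a k : Fin 2) {i j : ℕ} (h : i ≤ j) :
    entropy (fun w => top i (c.signal a k w)) ≤ entropy (fun w => top j (c.signal a k w)) :=
  entropy_mono fun _ _ hw => top_eq_top_iff.2 fun t l hl =>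
    top_eq_top_iff.1 hw t l (hl.trans_le h)

theorem entropy_top_signal_le_signal (a k : Fin 2) (j : ℕ) :
    entropy (fun w => top j (c.signal a k w)) ≤ entropy (c.signal a k) :=
  entropy_mono fun _ _ hw => by simp only [hw]

theorem entropy_outputs_le_top [Nonempty ((m k : Fin 2) → Fin (M m k))] (m : Fin 2) {j : ℕ}
    (hj : j ≤ N m m) :
    entropy (c.outputs g m) ≤ entropy (fun w => top j (c.outputs g m w)) +
      (T : ℝ) * ((N m m : ℝ) - j) * Real.log 2 := by
  have h1 := entropy_pair_le_add_log_card
    (fun w (t : Fin T) (i : Fin (N m m - j)) => c.outputs g m w t ⟨j + i, by omega⟩)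
    (fun w => top j (c.outputs g m w))
  have h2 : Real.log (Fintype.card (Fin T → Fin (N m m - j) → ZMod 2)) =
      (T : ℝ) * ((N m m : ℝ) - j) * Real.log 2 := by
    simp only [Fintype.card_fun, ZMod.card, Fintype.card_fin]
    push_cast
    rw [Real.log_pow, Real.log_pow, Nat.cast_sub hj, mul_assoc]
  rw [h2] at h1
  refine le_trans (entropy_mono fun w w' h => ?_) h1
  simp only [Prod.mk.injEq] at h
  funext t i
  by_cases hi : (i : ℕ) < j
  · exact top_eq_top_iff.1 h.2 t i hi
  · have := congrFun (congrFun h.1 t) ⟨i - j, by omega⟩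
    have e : (⟨j + (i - j), by omega⟩ : Fin (N m m)) = i := Fin.ext (by simp; omega)
    simpa only [e] using this

/-- The far transmitter does not reach these levels, and lower-triangularity keeps lower levels from
leaking up. -/
theorem entropy_top_outputs_le_of_le (m : Fin 2) {j : ℕ} (hj : j ≤ N m m - N m m.rev) :
    entropy (fun w => top j (c.outputs g m w)) ≤
      entropy (fun w => top j (c.signal m m w)) + entropy (fun w => top j (c.signal m.rev m w)) := by
  refine le_trans (entropy_mono fun w w' h => ?_) (entropy_pair_le_add _ _)
  simp only [Prod.mk.injEq, top_eq_top_iff] at h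
  refine top_eq_top_iff.2 fun t i hi => ?_
  rw [outputs_apply, outputs_apply, toeplitz_mulVec_congr _ (h.1 t) i hi]
  congr 1
  · congr 1
    refine toeplitz_mulVec_congr (j := j) _ (fun l hl => ?_) i hi
    rw [seen_eq_zero _ l (by omega), seen_eq_zero _ l (by omega)]
  · refine toeplitz_mulVec_congr (j := j) _ (fun l hl => ?_) i hi
    rw [Pi.add_apply, Pi.add_apply, seen_eq_zero _ l (by omega), seen_eq_zero _ l (by omega),
      h.2 t l hl]

theorem entropy_top_outputs_le (m : Fin 2) (hN : N m m.rev ≤ N m m) (j : ℕ) :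
    entropy (fun w => top j (c.outputs g m w)) ≤
      entropy (fun w => top j (c.signal m m w)) +
        entropy (fun w => top (N m m.rev) (c.signal m m.rev w)) +
        entropy (c.interference g m) := by
  refine le_trans (le_trans (entropy_mono fun w w' h => ?_) (entropy_pair_le_add
    (fun w => (top j (c.signal m m w), top (N m m.rev) (c.signal m m.rev w)))
    (c.interference g m))) (add_le_add_left (entropy_pair_le_add _ _) _)
  simp only [Prod.mk.injEq, top_eq_top_iff] at h
  refine top_eq_top_iff.2 fun t i hi => ?_
  rw [outputs_apply, outputs_apply, toeplitz_mulVec_congr _ (h.1.1 t) i hi, h.2,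
    seen_congr hN (h.1.2 t)]

/-- The messages for receiver `m`. -/
def desired (m : Fin 2) (w : (m k : Fin 2) → Fin (M m k)) : Fin (M m 0) × Fin (M m 1) :=
  (w m 0, w m 1)

/-- Knowing the desired messages, one may subtract their signals from the output and recover the
interference, which is independent of these messages. Hence H(W) + H(interference) ≤ H(W, output),
and Fano bounds the right side. -/
theorem desired_le_mutualInfo [Nonempty ((m k : Fin 2) → Fin (M m k))] (m : Fin 2)
    {ε : ℝ} (hε : c.errorProb g ≤ ε) :
    entropy (desired (M := M) m) ≤ entropy (c.outputs g m) - entropy (c.interference g m) +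
      Real.log 2 + ε * Real.log (Fintype.card (Fin (M m 0) × Fin (M m 1))) := by
  classical
  have hΩ : (0 : ℝ) < Fintype.card ((m k : Fin 2) → Fin (M m k)) := by
    exact_mod_cast Fintype.card_pos
  have h1 := fano (desired (M := M) m) (c.outputs g m) (fun y => (c.dec m 0 y, c.dec m 1 y))
    (ε := ε) (by
      rw [errorProb, Nat.card_eq_fintype_card, div_le_iff₀ hΩ] at hε
      refine le_trans ?_ hε
      refine Nat.cast_le.2 (Set.ncard_le_ncard ?_ (Set.toFinite _))
      intro w hw
      by_contra hc
      simp only [Set.mem_ofPred_eq, not_exists, not_not] at hc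
      exact hw (Prod.ext (hc m 0) (hc m 1)))
  have h2 := entropy_pair_of_mix (mix fun i _ => decide (i = m)) (desired (M := M) m)
    (c.interference g m) (mix_mix _) (fun x y => by simp [desired, mix])
    (fun x y => by
      have : ∀ m : Fin 2, m.rev ≠ m := by decide
      funext t
      simp only [interference, signal, mix, this, decide_false, Bool.false_eq_true, if_false])
  have h3 : entropy (fun w => (desired (M := M) m w, c.interference g m w)) ≤
      entropy (fun w => (desired (M := M) m w, c.outputs g m w)) := entropy_mono fun w w' h => by
    simp only [Prod.mk.injEq] at h ⊢
    refine ⟨h.1, funext fun t => funext fun i => ?_⟩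
    have h4 := congrFun (congrFun h.2 t) i
    have h5 : ∀ k, c.signal m k w = c.signal m k w' := by
      have h6 := h.1
      simp only [desired, Prod.mk.injEq] at h6
      intro k
      fin_cases k
      · simp [signal, h6.1]
      · simp [signal, h6.2]
    rw [outputs_apply, outputs_apply, h5, h5] at h4
    exact add_left_cancel h4
  linarith

theorem log_card_le [Nonempty ((m k : Fin 2) → Fin (M m k))] {ε : ℝ} (hε : c.errorProb g ≤ ε) :
    (1 - ε) * Real.log (Fintype.card ((m k : Fin 2) → Fin (M m k))) ≤
      entropy (c.outputs g 0) + entropy (c.outputs g 1) - entropy (c.interference g 0) -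
        entropy (c.interference g 1) + 2 * Real.log 2 := by
  have h0 := c.desired_le_mutualInfo g 0 hε
  have h1 := c.desired_le_mutualInfo g 1 hε
  have h2 := entropy_pair_le_add (desired (M := M) 0) (desired (M := M) 1)
  have h3 := entropy_id (Ω := (m k : Fin 2) → Fin (M m k))
  have h4 : entropy (fun w : (m k : Fin 2) → Fin (M m k) => w) ≤
      entropy (fun w => (desired (M := M) 0 w, desired (M := M) 1 w)) :=
    entropy_mono fun w w' h => by
      simp only [desired, Prod.mk.injEq] at h
      funext m k
      fin_cases m <;> fin_cases k
      · exact h.1.1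
      · exact h.1.2
      · exact h.2.1
      · exact h.2.2
  have hp : ∀ m k, (M m k : ℝ) ≠ 0 := fun m k => by
    obtain ⟨w⟩ := ‹Nonempty ((m k : Fin 2) → Fin (M m k))›
    have := (w m k).2
    have : M m k ≠ 0 := by omega
    exact_mod_cast this
  have h5 : Real.log (Fintype.card ((m k : Fin 2) → Fin (M m k))) =
      Real.log (Fintype.card (Fin (M 0 0) × Fin (M 0 1))) +
        Real.log (Fintype.card (Fin (M 1 0) × Fin (M 1 1))) := by
    simp only [Fintype.card_pi, Fintype.card_prod, Fintype.card_fin, Fin.prod_univ_two]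
    push_cast
    rw [Real.log_mul (mul_ne_zero (hp _ _) (hp _ _)) (mul_ne_zero (hp _ _) (hp _ _))]
  have h6 : ε * Real.log (Fintype.card ((m k : Fin 2) → Fin (M m k))) =
      ε * Real.log (Fintype.card (Fin (M 0 0) × Fin (M 0 1))) +
        ε * Real.log (Fintype.card (Fin (M 1 0) × Fin (M 1 1))) := by
    rw [h5, mul_add]
  linarith

end Code

end Converse

/-! ### The four upper bounds on the sum capacity -/

section ConverseBound

variable {N : Fin 2 → Fin 2 → ℕ}

theorem entropy_top_zero {Ω : Type*} [Fintype Ω] {T n : ℕ} (f : Ω → Fin T → Fin n → ZMod 2) :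
    entropy (fun w => top 0 (f w)) = 0 := by
  have : (fun w => top 0 (f w)) = fun _ => 0 := by
    funext w t i
    simp [top]
  rw [this, entropy_const]

theorem Code.entropy_sub_le {T : ℕ} {M : Fin 2 → Fin 2 → ℕ} (c : Code N T M)
    (g : Fin 2 → Fin 3 → ℝ) [Nonempty ((m k : Fin 2) → Fin (M m k))]
    (hN : max (N 0 1) (N 1 0) ≤ min (N 0 0) (N 1 1)) :
    entropy (c.outputs g 0) + entropy (c.outputs g 1) - entropy (c.interference g 0) -
      entropy (c.interference g 1) ≤ T * Real.log 2 * D N := by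
  simp only [max_le_iff, le_min_iff] at hN
  obtain ⟨⟨hpa, hqa⟩, hpb, hqb⟩ := hN
  have hl : 0 ≤ (T : ℝ) * Real.log 2 := by positivity
  -- The part of the top `N 1 0` levels at the first receiver that is free of the far transmitter;
  -- `j₁` is its mirror image. The levels below the cut account for the positive parts in D₁, D₂, D₃
  -- (`J0`, `J1`).
  set j₀ := min (N 1 0) (N 0 0 - N 0 1) with hj₀
  set j₁ := min (N 0 1) (N 1 1 - N 1 0) with hj₁
  have r0 : Fin.rev (0 : Fin 2) = 1 := rfl
  have r1 : Fin.rev (1 : Fin 2) = 0 := rfl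
  have I0 : entropy (fun w => top j₀ (c.signal 1 0 w)) +
      entropy (fun w => top (N 0 1) (c.signal 1 1 w)) ≤ entropy (c.interference g 0) :=
    c.le_entropy_interference g (m := 0) (by rwa [r0]) (j := j₀) (by rw [r0]; omega)
  have I1 : entropy (fun w => top j₁ (c.signal 0 1 w)) +
      entropy (fun w => top (N 1 0) (c.signal 0 0 w)) ≤ entropy (c.interference g 1) :=
    c.le_entropy_interference g (m := 1) (by rwa [r1]) (j := j₁) (by rw [r1]; omega)
  have S0 := (c.entropy_top_signal_le_signal 1 0 (N 1 0)).trans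
    (c.entropy_signal_le_interference g 0)
  have S1 := (c.entropy_top_signal_le_signal 0 1 (N 0 1)).trans
    (c.entropy_signal_le_interference g 1)
  have Z0 := entropy_nonneg fun w => top j₀ (c.signal 1 0 w)
  have Z1 := entropy_nonneg fun w => top j₁ (c.signal 0 1 w)
  have T0 := c.entropy_top_signal_le 0 0 (i := j₀) (j := N 1 0) (by omega)
  have T1 := c.entropy_top_signal_le 1 1 (i := j₁) (j := N 0 1) (by omega)
  have U0 := c.entropy_outputs_le_top g 0 (j := j₀) (by omega)
  have U1 := c.entropy_outputs_le_top g 1 (j := j₁) (by omega)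
  have V0 := c.entropy_outputs_le_top g 0 (j := N 1 0) hqa
  have V1 := c.entropy_outputs_le_top g 1 (j := N 0 1) hpb
  have W0 := c.entropy_outputs_le_top g 0 (j := 0) (by omega)
  have W1 := c.entropy_outputs_le_top g 1 (j := 0) (by omega)
  have C0 : entropy (fun w => top 0 (c.outputs g 0 w)) = 0 := entropy_top_zero _
  have C1 : entropy (fun w => top 0 (c.outputs g 1 w)) = 0 := entropy_top_zero _
  have P0 : entropy (fun w => top j₀ (c.outputs g 0 w)) ≤
      entropy (fun w => top j₀ (c.signal 0 0 w)) + entropy (fun w => top j₀ (c.signal 1 0 w)) :=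
    c.entropy_top_outputs_le_of_le g 0 (j := j₀) (by rw [r0]; omega)
  have P1 : entropy (fun w => top j₁ (c.outputs g 1 w)) ≤
      entropy (fun w => top j₁ (c.signal 1 1 w)) + entropy (fun w => top j₁ (c.signal 0 1 w)) :=
    c.entropy_top_outputs_le_of_le g 1 (j := j₁) (by rw [r1]; omega)
  have Q0 : entropy (fun w => top (N 1 0) (c.outputs g 0 w)) ≤
      entropy (fun w => top (N 1 0) (c.signal 0 0 w)) +
      entropy (fun w => top (N 0 1) (c.signal 0 1 w)) + entropy (c.interference g 0) :=
    c.entropy_top_outputs_le g 0 (by rwa [r0]) (N 1 0)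
  have Q1 : entropy (fun w => top (N 0 1) (c.outputs g 1 w)) ≤
      entropy (fun w => top (N 0 1) (c.signal 1 1 w)) +
      entropy (fun w => top (N 1 0) (c.signal 1 0 w)) + entropy (c.interference g 1) :=
    c.entropy_top_outputs_le g 1 (by rwa [r1]) (N 0 1)
  simp only [C0, C1, Nat.cast_zero, sub_zero, zero_add] at W0 W1
  have J0 : (N 0 0 : ℝ) - j₀ = (N 0 0 : ℝ) - N 1 0 + max ((N 0 1 : ℝ) + N 1 0 - N 0 0) 0 := by
    rw [hj₀, Nat.cast_min, Nat.cast_sub hpa]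
    rcases le_total ((N 0 1 : ℝ) + N 1 0 - N 0 0) 0 with h | h
    · rw [max_eq_right h, min_eq_left (by linarith)]; ring
    · rw [max_eq_left h, min_eq_right (by linarith)]; ring
  have J1 : (N 1 1 : ℝ) - j₁ = (N 1 1 : ℝ) - N 0 1 + max ((N 0 1 : ℝ) + N 1 0 - N 1 1) 0 := by
    rw [hj₁, Nat.cast_min, Nat.cast_sub hqb]
    rcases le_total ((N 0 1 : ℝ) + N 1 0 - N 1 1) 0 with h | h
    · rw [max_eq_right h, min_eq_left (by linarith)]; ring
    · rw [max_eq_left h, min_eq_right (by linarith)]; ring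
  rw [J0] at U0
  rw [J1] at U1
  rw [D, add_assoc, mul_add, ← sub_le_iff_le_add, mul_min_of_nonneg _ _ hl,
    mul_min_of_nonneg _ _ hl, mul_min_of_nonneg _ _ hl]
  refine le_min (le_min ?_ ?_) (le_min ?_ ?_)
  -- Both outputs are cut at `j₀`, `j₁` (`U`, `P`); `I0` and `I1` absorb all signal entropies.
  · rw [D1]
    linarith
  -- Twice the bound: each output once by its full length (`W`), then the first by `V0`, `Q0` and
  -- the second by `U1`, `P1`. The remaining one `interference 0` and two `interference 1` absorb
  -- the signals through `I0`, `I1`, `S1`. D₃ is the mirror image.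
  · rw [D2]
    linarith
  · rw [D3]
    linarith
  -- Three times the bound: each output twice by its full length and once by `V`, `Q`; `I` and `S`
  -- absorb the four signal terms.
  · rw [D4]
    linarith

theorem sumCapacity_le {g : Fin 2 → Fin 3 → ℝ}
    (hN : max (N 0 1) (N 1 0) ≤ min (N 0 0) (N 1 1)) :
    sumCapacity N g ≤ ((D N : ℝ) : EReal) := by
  refine sSup_le ?_
  rintro _ ⟨R, ⟨hR, hach⟩, rfl⟩
  refine EReal.coe_le_coe_iff.2 ?_
  have hl : 0 < Real.log 2 := Real.log_pos (by norm_num)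
  have key : ∀ ε : ℝ, 0 < ε → ε < 1 → (1 - ε) * ∑ m, ∑ k, R m k ≤ D N := by
    intro ε h0 h1
    obtain ⟨T₀, hT⟩ := hach ε h0
    refine le_of_forall_pos_le_add fun η hη => ?_
    obtain ⟨n, hn⟩ := exists_nat_gt (2 / η)
    -- Long enough that the constant 2 log 2 from Fano is at most T η log 2.
    set T := max T₀ (n + 1) with hTdef
    obtain ⟨M, c, hM, hc⟩ := hT T (le_max_left _ _)
    have hTn : ((n + 1 : ℕ) : ℝ) ≤ T := by exact_mod_cast le_max_right _ _
    have hT0 : (0 : ℝ) < T := lt_of_lt_of_le (by positivity) hTn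
    have hMpos : ∀ m k, (0 : ℝ) < M m k := fun m k => lt_of_lt_of_le (by positivity) (hM m k)
    have hne : Nonempty ((m k : Fin 2) → Fin (M m k)) :=
      ⟨fun m k => ⟨0, by exact_mod_cast hMpos m k⟩⟩
    have h2 := c.log_card_le g hc
    have h3 := c.entropy_sub_le g hN
    have h4 : (T : ℝ) * Real.log 2 * ∑ m, ∑ k, R m k ≤
        Real.log (Fintype.card ((m k : Fin 2) → Fin (M m k))) := by
      simp only [Fintype.card_pi, Fintype.card_fin, Nat.cast_prod]
      rw [Real.log_prod fun m _ => (Finset.prod_pos fun k _ => hMpos m k).ne', Finset.mul_sum]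
      refine Finset.sum_le_sum fun m _ => ?_
      rw [Real.log_prod fun k _ => (hMpos m k).ne', Finset.mul_sum]
      refine Finset.sum_le_sum fun k _ => ?_
      have := Real.log_le_log (by positivity) (hM m k)
      rw [Real.log_rpow (by norm_num)] at this
      linarith
    have h5 := mul_le_mul_of_nonneg_left h4 (sub_nonneg.2 h1.le)
    have h6 : (T : ℝ) * Real.log 2 * ((1 - ε) * ∑ m, ∑ k, R m k) ≤
        (T : ℝ) * Real.log 2 * (D N + η) := by
      have h7 : 2 ≤ T * η := by
        rw [div_lt_iff₀ hη] at hn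
        have : (n : ℝ) * η ≤ T * η := by
          refine mul_le_mul_of_nonneg_right ?_ hη.le
          push_cast at hTn; linarith
        linarith
      have h8 := mul_le_mul_of_nonneg_right h7 hl.le
      linarith
    exact le_of_mul_le_mul_left h6 (by positivity)
  refine le_of_forall_pos_le_add fun η hη => ?_
  have hS : 0 ≤ ∑ m, ∑ k, R m k := Finset.sum_nonneg fun m _ => Finset.sum_nonneg fun k _ => hR m k
  set S := ∑ m, ∑ k, R m k
  have h1 := key (min (1 / 2) (η / (S + 1))) (by positivity)
    (lt_of_le_of_lt (min_le_left _ _) (by norm_num))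
  have h2 : min (1 / 2) (η / (S + 1)) * S ≤ η := by
    calc min (1 / 2) (η / (S + 1)) * S ≤ η / (S + 1) * S :=
          mul_le_mul_of_nonneg_right (min_le_right _ _) hS
      _ ≤ η := by
        rw [div_mul_eq_mul_div, div_le_iff₀ (by positivity)]
        nlinarith
  linarith

end ConverseBound

/-! ### Measure of the gains for which bit patterns collide -/

section Gains

open MeasureTheory PowerSeries
open scoped ENNReal

theorem binDigit_zero {x : ℝ} (hx : x ∈ Set.Ioc (1 : ℝ) 2) : binDigit x 0 = 1 := by
  unfold binDigit
  split_ifs with h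
  · rfl
  · have h2 : x < 2 := lt_of_le_of_ne hx.2 h
    have : ⌊x⌋ = 1 := Int.floor_eq_iff.2 ⟨by simpa using hx.1.le, by norm_num; exact h2⟩
    simp [this]

theorem floor_two_pow_mul_eq {x y : ℝ} (hx : x ∈ Set.Ioc (1 : ℝ) 2) (hy : y ∈ Set.Ioc (1 : ℝ) 2)
    (hx2 : x ≠ 2) (hy2 : y ≠ 2) {m : ℕ} (h : ∀ j ≤ m, binDigit x j = binDigit y j) :
    ⌊(2 : ℝ) ^ m * x⌋ = ⌊(2 : ℝ) ^ m * y⌋ := by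
  induction m with
  | zero =>
    have key : ∀ z ∈ Set.Ioc (1 : ℝ) 2, z ≠ 2 → ⌊(2 : ℝ) ^ 0 * z⌋ = 1 := fun z hz h =>
      Int.floor_eq_iff.2 ⟨by simpa using hz.1.le, by
        have := lt_of_le_of_ne hz.2 h; norm_num; exact this⟩
    rw [key x hx hx2, key y hy hy2]
  | succ m ih =>
    have h1 := ih fun j hj => h j (by omega)
    have h2 := h (m + 1) le_rfl
    simp only [binDigit, hx2, hy2, if_false] at h2
    rw [ZMod.intCast_eq_intCast_iff_dvd_sub] at h2
    have key : ∀ z : ℝ, ⌊(2 : ℝ) ^ (m + 1) * z⌋ = 2 * ⌊(2 : ℝ) ^ m * z⌋ ∨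
        ⌊(2 : ℝ) ^ (m + 1) * z⌋ = 2 * ⌊(2 : ℝ) ^ m * z⌋ + 1 := by
      intro z
      have e : (2 : ℝ) ^ (m + 1) * z = 2 * ((2 : ℝ) ^ m * z) := by ring
      rw [e]
      set w := (2 : ℝ) ^ m * z
      have h1 := Int.floor_le w
      have h2 := Int.lt_floor_add_one w
      have h3 : 2 * ⌊w⌋ ≤ ⌊2 * w⌋ := Int.le_floor.2 (by push_cast; linarith)
      have h4 : ⌊2 * w⌋ < 2 * ⌊w⌋ + 2 := Int.floor_lt.2 (by push_cast; linarith)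
      omega
    have := key x
    have := key y
    push_cast at h2
    omega

/-- Gains that agree in the first `m` digits lie in a set of measure `2 ^ (-m)`. -/
theorem volume_le_of_binDigit_eq {S : Set ℝ} (hS : S ⊆ Set.Ioc (1 : ℝ) 2) (m : ℕ)
    (h : ∀ x ∈ S, ∀ y ∈ S, ∀ j ≤ m, binDigit x j = binDigit y j) :
    volume S ≤ (2 : ℝ≥0∞)⁻¹ ^ m := by
  -- The point 2, whose digits follow a different convention, is a null set.
  have h0 : volume S ≤ volume (S \ {2}) := by
    refine (measure_mono (t := (S \ {2}) ∪ {2}) fun y hy => by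
      by_cases h : y = 2 <;> simp [h, hy]).trans ((measure_union_le _ _).trans ?_)
    simp
  refine h0.trans ?_
  rcases (S \ {2}).eq_empty_or_nonempty with he | ⟨x, hx⟩
  · simp [he]
  have hp : (0 : ℝ) < 2 ^ m := by positivity
  have hsub : S \ {2} ⊆ Set.Ico ((⌊(2 : ℝ) ^ m * x⌋ : ℝ) / 2 ^ m)
      ((⌊(2 : ℝ) ^ m * x⌋ + 1 : ℝ) / 2 ^ m) := by
    intro y hy
    have e := floor_two_pow_mul_eq (hS hx.1) (hS hy.1) hx.2 hy.2 (h x hx.1 y hy.1)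
    rw [e, Set.mem_Ico, div_le_iff₀ hp, lt_div_iff₀ hp, mul_comm y]
    exact ⟨Int.floor_le _, Int.lt_floor_add_one _⟩
  refine (measure_mono hsub).trans ?_
  rw [Real.volume_Ico]
  have : ((⌊(2 : ℝ) ^ m * x⌋ + 1 : ℝ) / 2 ^ m) - ((⌊(2 : ℝ) ^ m * x⌋ : ℝ) / 2 ^ m) =
      (2⁻¹ : ℝ) ^ m := by
    rw [← sub_div, add_sub_cancel_left, one_div, inv_pow]
  rw [this, ENNReal.ofReal_pow (by norm_num), ENNReal.ofReal_inv_of_pos (by norm_num)]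
  simp

/-- The power series of the digits of a gain. -/
noncomputable def gainSeries (x : ℝ) : (ZMod 2)⟦X⟧ := PowerSeries.mk (binDigit x)

/-- The power series with coefficient one exactly at the positions in `S`. -/
noncomputable def indSeries (S : Finset ℕ) : (ZMod 2)⟦X⟧ :=
  PowerSeries.mk fun j => if j ∈ S then 1 else 0

theorem le_order_indSeries {S : Finset ℕ} {ν : ℕ} (h : ∀ j ∈ S, ν ≤ j) :
    (ν : ℕ∞) ≤ (indSeries S).order := by
  refine PowerSeries.nat_le_order _ _ fun i hi => ?_
  have : i ∉ S := fun hs => absurd (h i hs) (by omega)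
  simp [indSeries, this]

theorem order_indSeries {S : Finset ℕ} {ν : ℕ} (hν : ν ∈ S) (h : ∀ j ∈ S, ν ≤ j) :
    (indSeries S).order = ν := by
  refine le_antisymm (PowerSeries.order_le _ ?_) (le_order_indSeries h)
  simp [indSeries, hν]

/-- The combination of three bit patterns, modulated by the three gains at a receiver. -/
noncomputable def combination (g : Fin 3 → ℝ) (S : Fin 3 → Finset ℕ) : (ZMod 2)⟦X⟧ :=
  ∑ k, gainSeries (g k) * indSeries (S k)

theorem coeff_mul_congr {f f' h : (ZMod 2)⟦X⟧} {n : ℕ}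
    (hf : ∀ j < n, coeff j f = coeff j f') (i : ℕ) (hi : i < n) :
    coeff i (f * h) = coeff i (f' * h) := by
  rw [coeff_mul, coeff_mul]
  refine Finset.sum_congr rfl fun p hp => ?_
  rw [hf p.1 (by have := Finset.HasAntidiagonal.mem_antidiagonal.1 hp; omega)]

/-- Orders add in ℤ₂⟦X⟧, so cancelling a factor of order ν costs exactly ν known coefficients. -/
theorem coeff_eq_of_coeff_mul_eq {f f' h : (ZMod 2)⟦X⟧} {n ν : ℕ} (hh : h.order = ν)
    (H : ∀ i < n, coeff i (f * h) = coeff i (f' * h)) (j : ℕ) (hj : j + ν < n) :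
    coeff j f = coeff j f' := by
  have h1 : (n : ℕ∞) ≤ ((f - f') * h).order := PowerSeries.nat_le_order _ _ fun i hi => by
    rw [sub_mul, map_sub, H i hi, sub_self]
  rw [PowerSeries.order_mul, hh] at h1
  have h2 : (j : ℕ∞) < (f - f').order := by
    by_contra hc
    have h3 : (f - f').order + ν ≤ (j : ℕ∞) + ν := add_le_add_left (not_lt.1 hc) _
    have h4 := h1.trans h3
    norm_cast at h4
    omega
  have := PowerSeries.coeff_of_lt_order _ h2
  rwa [map_sub, sub_eq_zero] at this

/-- Fix the first n - 1 fractional digits of the other two gains. The equation then determines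
digits 0, …, n - 1 - ν of gain `k`, of which digit 0 is always one. Summing over the cells of the
other two gains costs nothing, as their bounds add up to one. -/
theorem volume_combination_eq_zero_le (S : Fin 3 → Finset ℕ) (k : Fin 3) {n ν : ℕ}
    (hν : ν ∈ S k) (hmin : ∀ j ∈ S k, ν ≤ j) (hn : ν < n) :
    volume {g : Fin 3 → ℝ | (∀ i, g i ∈ Set.Ioc (1 : ℝ) 2) ∧
      ∀ i < n, coeff i (combination g S) = 0} ≤ (2 : ℝ≥0∞)⁻¹ ^ (n - 1 - ν) := by
  classical
  obtain ⟨d, rfl⟩ : ∃ d, n = d + 1 := ⟨n - 1, by omega⟩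
  let cell : (Fin d → ZMod 2) → Set ℝ := fun e =>
    {x | x ∈ Set.Ioc (1 : ℝ) 2 ∧ ∀ j : Fin d, binDigit x (j + 1) = e j}
  have cell_eq : ∀ e, ∀ x ∈ cell e, ∀ y ∈ cell e, ∀ j < d + 1, binDigit x j = binDigit y j := by
    intro e x hx y hy j hj
    rcases j with _ | j
    · rw [binDigit_zero hx.1, binDigit_zero hy.1]
    · rw [hx.2 ⟨j, by omega⟩, hy.2 ⟨j, by omega⟩]
  have vol_cell : ∀ e, volume (cell e) ≤ (2 : ℝ≥0∞)⁻¹ ^ d := fun e =>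
    volume_le_of_binDigit_eq (fun x hx => hx.1) d fun x hx y hy j hj =>
      cell_eq e x hx y hy j (by omega)
  let slice : (Fin d → ZMod 2) × (Fin d → ZMod 2) → Set ℝ := fun e =>
    {x | ∃ g : Fin 3 → ℝ, g k = x ∧ (∀ i, g i ∈ Set.Ioc (1 : ℝ) 2) ∧ g (k + 1) ∈ cell e.1 ∧
      g (k + 2) ∈ cell e.2 ∧ ∀ i < d + 1, coeff i (combination g S) = 0}
  have expand : ∀ g : Fin 3 → ℝ, combination g S = gainSeries (g k) * indSeries (S k) +
      (gainSeries (g (k + 1)) * indSeries (S (k + 1)) +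
        gainSeries (g (k + 2)) * indSeries (S (k + 2))) := by
    intro g
    rw [combination, Fin.sum_univ_three]
    fin_cases k
    · exact add_assoc _ _ _
    · exact (add_assoc _ _ _).trans ((add_left_comm _ _ _).trans (congrArg _ (add_comm _ _)))
    · exact add_comm _ _
  have vol_slice : ∀ e, volume (slice e) ≤ (2 : ℝ≥0∞)⁻¹ ^ (d + 1 - 1 - ν) := by
    intro e
    refine volume_le_of_binDigit_eq ?_ _ ?_
    · rintro _ ⟨g, rfl, hg, -⟩
      exact hg k
    · rintro _ ⟨g, rfl, hg, hg1, hg2, hg0⟩ _ ⟨g', rfl, hg', hg1', hg2', hg0'⟩ j hj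
      have := coeff_eq_of_coeff_mul_eq (f := gainSeries (g k)) (f' := gainSeries (g' k))
        (n := d + 1) (order_indSeries hν hmin) (fun i hi => by
          have h1 := hg0 i hi
          have h2 := hg0' i hi
          rw [expand, map_add, map_add] at h1 h2
          have h3 : coeff i (gainSeries (g (k + 1)) * indSeries (S (k + 1))) =
              coeff i (gainSeries (g' (k + 1)) * indSeries (S (k + 1))) :=
            coeff_mul_congr (n := d + 1) (fun j hj => by
              simpa [gainSeries] using cell_eq _ _ hg1 _ hg1' j hj) i hi
          have h4 : coeff i (gainSeries (g (k + 2)) * indSeries (S (k + 2))) =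
              coeff i (gainSeries (g' (k + 2)) * indSeries (S (k + 2))) :=
            coeff_mul_congr (n := d + 1) (fun j hj => by
              simpa [gainSeries] using cell_eq _ _ hg2 _ hg2' j hj) i hi
          rw [h3, h4] at h1
          exact add_right_cancel (h1.trans h2.symm)) j (by omega)
      simpa [gainSeries] using this
  let box : (Fin d → ZMod 2) × (Fin d → ZMod 2) → Set (Fin 3 → ℝ) := fun e =>
    Set.univ.pi fun i => if i = k then slice e else if i = k + 1 then cell e.1 else cell e.2
  have hsub : {g : Fin 3 → ℝ | (∀ i, g i ∈ Set.Ioc (1 : ℝ) 2) ∧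
      ∀ i < d + 1, coeff i (combination g S) = 0} ⊆ ⋃ e, box e := by
    rintro g ⟨hg, h0⟩
    refine Set.mem_iUnion.2 ⟨(fun j => binDigit (g (k + 1)) (j + 1),
      fun j => binDigit (g (k + 2)) (j + 1)), ?_⟩
    intro i _
    have hi : i = k ∨ i = k + 1 ∨ i = k + 2 :=
      (by decide : ∀ i k : Fin 3, i = k ∨ i = k + 1 ∨ i = k + 2) i k
    have n1 : k + 1 ≠ k := (by decide : ∀ k : Fin 3, k + 1 ≠ k) k
    have n2 : k + 2 ≠ k := (by decide : ∀ k : Fin 3, k + 2 ≠ k) k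
    have n3 : k + 2 ≠ k + 1 := (by decide : ∀ k : Fin 3, k + 2 ≠ k + 1) k
    rcases hi with rfl | rfl | rfl
    · simp only [if_true]
      exact ⟨g, rfl, hg, ⟨hg _, fun j => rfl⟩, ⟨hg _, fun j => rfl⟩, h0⟩
    · simp only [n1, if_false, if_true]
      exact ⟨hg _, fun j => rfl⟩
    · simp only [n2, n3, if_false]
      exact ⟨hg _, fun j => rfl⟩
  have vol_box : ∀ e, volume (box e) ≤
      (2 : ℝ≥0∞)⁻¹ ^ (d + 1 - 1 - ν) * ((2 : ℝ≥0∞)⁻¹ ^ d * (2 : ℝ≥0∞)⁻¹ ^ d) := by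
    intro e
    have : volume (box e) = volume (slice e) * (volume (cell e.1) * volume (cell e.2)) := by
      rw [volume_pi_pi, Fin.prod_univ_three]
      fin_cases k
      · simp [mul_assoc]
      · simp; ring
      · simp; ring
    rw [this]
    gcongr
    · exact vol_slice e
    · exact vol_cell _
    · exact vol_cell _
  refine (measure_mono hsub).trans ((measure_iUnion_fintype_le _ _).trans
    ((Finset.sum_le_sum fun e _ => vol_box e).trans ?_))
  rw [Finset.sum_const, Finset.card_univ, Fintype.card_prod, Fintype.card_fun, ZMod.card,
    Fintype.card_fin, nsmul_eq_mul]
  have h2 : ((2 : ℝ≥0∞) ^ d) * (2 : ℝ≥0∞)⁻¹ ^ d = 1 := by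
    rw [← mul_pow, ENNReal.mul_inv_cancel (by norm_num) (by norm_num), one_pow]
  generalize d + 1 - 1 - ν = w
  push_cast
  calc _ = (2 : ℝ≥0∞)⁻¹ ^ w * ((2 ^ d * (2 : ℝ≥0∞)⁻¹ ^ d) *
        (2 ^ d * (2 : ℝ≥0∞)⁻¹ ^ d)) := by ring
    _ ≤ _ := by rw [h2]; simp

/-- The bit patterns in `P` can be told apart from the first `n` coefficients of their
combination. -/
def Resolvable (n : ℕ) (P : Fin 3 → Finset ℕ) (g : Fin 3 → ℝ) : Prop :=
  ∀ S : Fin 3 → Finset ℕ, (∀ k, S k ⊆ P k) → (∀ i < n, coeff i (combination g S) = 0) →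
    ∀ k, S k = ∅

theorem coeff_gainSeries_mul_indSeries {x : ℝ} (hx : x ∈ Set.Ioc (1 : ℝ) 2) {S : Finset ℕ} {ν : ℕ}
    (h : ∀ j ∈ S, ν ≤ j) :
    coeff ν (gainSeries x * indSeries S) = if ν ∈ S then 1 else 0 := by
  rw [coeff_mul, Finset.sum_eq_single (0, ν)]
  · simp [gainSeries, indSeries, binDigit_zero hx]
  · rintro ⟨i, j⟩ hij hne
    have h1 : i + j = ν := Finset.HasAntidiagonal.mem_antidiagonal.1 hij
    have h2 : j ∉ S := fun hj => by
      have := h j hj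
      exact hne (by ext <;> simp <;> omega)
    simp [indSeries, h2]
  · intro h
    exact absurd (Finset.HasAntidiagonal.mem_antidiagonal.2 (zero_add ν)) h

/-- At the first occupied level ν the coefficient is the parity of the number of patterns containing
ν, because digit 0 of every gain is one. A vanishing parity forces two patterns to share ν; `l` is
the index left out of that pair. -/
theorem exists_collision {n : ℕ} {g : Fin 3 → ℝ} (hg : ∀ k, g k ∈ Set.Ioc (1 : ℝ) 2)
    {S : Fin 3 → Finset ℕ} (hn : ∀ k, ∀ j ∈ S k, j < n)
    (h0 : ∀ i < n, coeff i (combination g S) = 0) (hne : ∃ k, S k ≠ ∅) :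
    ∃ ν, (∀ k, ∀ j ∈ S k, ν ≤ j) ∧ ∃ l : Fin 3, ν ∈ S (l + 1) ∧ ν ∈ S (l + 2) := by
  classical
  have hex : ∃ ν, ∃ k, ν ∈ S k := by
    obtain ⟨k, hk⟩ := hne
    obtain ⟨ν, hν⟩ := Finset.nonempty_iff_ne_empty.2 hk
    exact ⟨ν, k, hν⟩
  have hmin : ∀ k, ∀ j ∈ S k, Nat.find hex ≤ j := fun k j hj => Nat.find_min' hex ⟨k, hj⟩
  refine ⟨Nat.find hex, hmin, ?_⟩
  obtain ⟨k, hk⟩ := Nat.find_spec hex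
  set ν := Nat.find hex
  have h1 := h0 ν (hn k ν hk)
  rw [combination, map_sum, Fin.sum_univ_three, coeff_gainSeries_mul_indSeries (hg 0) (hmin 0),
    coeff_gainSeries_mul_indSeries (hg 1) (hmin 1),
    coeff_gainSeries_mul_indSeries (hg 2) (hmin 2)] at h1
  by_cases m0 : ν ∈ S 0 <;> by_cases m1 : ν ∈ S 1 <;> by_cases m2 : ν ∈ S 2
  · exact ⟨0, m1, m2⟩
  · exact ⟨2, m0, m1⟩
  · exact ⟨1, m2, m0⟩
  · simp [m0, m1, m2] at h1
  · exact ⟨0, m1, m2⟩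
  · simp [m0, m1, m2] at h1
  · simp [m0, m1, m2] at h1
  · fin_cases k
    · exact absurd hk m0
    · exact absurd hk m1
    · exact absurd hk m2

theorem sum_geometric_le (F : Finset ℕ) (x : ℕ) (hx : ∀ ν ∈ F, x ≤ ν) :
    ∑ ν ∈ F, (2 : ℝ≥0∞)⁻¹ ^ (ν - x) ≤ 2 := by
  classical
  have hinj : Set.InjOn (fun ν => ν - x) (F : Set ℕ) := fun a ha b hb h => by
    have := hx a ha
    have := hx b hb
    simp only at h
    omega
  rw [← Finset.sum_image (f := fun j => (2 : ℝ≥0∞)⁻¹ ^ j) hinj]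
  refine (ENNReal.sum_le_tsum _).trans ?_
  rw [ENNReal.tsum_geometric, ENNReal.one_sub_inv_two, inv_inv]

/-- If at every level at which two patterns may collide, the number of bits at or below this level
leaves a slack of `K`, growing along each run of collisions, then the patterns are resolvable
except for a set of gains of measure `12 * 2 ^ (-K)`. -/
theorem volume_not_resolvable_le (n K : ℕ) (P : Fin 3 → Finset ℕ) (hP : ∀ k, P k ⊆ Finset.range n)
    (x : Fin 3 → ℕ) (hx : ∀ l, ∀ ν ∈ P (l + 1) ∩ P (l + 2), x l ≤ ν ∧
      (∑ k, ((P k).filter (ν ≤ ·)).card) + K + (ν - x l) ≤ n - ν) :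
    volume {g : Fin 3 → ℝ | (∀ k, g k ∈ Set.Ioc (1 : ℝ) 2) ∧ ¬ Resolvable n P g} ≤
      12 * (2 : ℝ≥0∞)⁻¹ ^ K := by
  classical
  let Q : ℕ → Finset (Fin 3 → Finset ℕ) := fun ν =>
    Fintype.piFinset fun k => ((P k).filter (ν ≤ ·)).powerset
  let E : (Fin 3 → Finset ℕ) → Set (Fin 3 → ℝ) := fun S =>
    {g | (∀ i, g i ∈ Set.Ioc (1 : ℝ) 2) ∧ ∀ i < n, coeff i (combination g S) = 0}
  have hsub : {g : Fin 3 → ℝ | (∀ k, g k ∈ Set.Ioc (1 : ℝ) 2) ∧ ¬ Resolvable n P g} ⊆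
      ⋃ l : Fin 3, ⋃ ν ∈ P (l + 1) ∩ P (l + 2), ⋃ S ∈ (Q ν).filter (fun S => ν ∈ S (l + 1)),
        E S := by
    rintro g ⟨hg, hr⟩
    simp only [Resolvable, not_forall] at hr
    obtain ⟨S, hS, h0, k, hk⟩ := hr
    obtain ⟨ν, hmin, l, h1, h2⟩ := exists_collision hg
      (fun k j hj => Finset.mem_range.1 (hP k (hS k hj))) h0 ⟨k, hk⟩
    simp only [Set.mem_iUnion]
    refine ⟨l, ν, Finset.mem_inter.2 ⟨hS _ h1, hS _ h2⟩, S, ?_, hg, h0⟩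
    refine Finset.mem_filter.2 ⟨Fintype.mem_piFinset.2 fun k => Finset.mem_powerset.2 fun j hj =>
      Finset.mem_filter.2 ⟨hS k hj, hmin k j hj⟩, h1⟩
  have hc : (2 : ℝ≥0∞) * 2⁻¹ = 1 := ENNReal.mul_inv_cancel (by norm_num) (by norm_num)
  have hterm : ∀ l, ∀ ν ∈ P (l + 1) ∩ P (l + 2),
      volume (⋃ S ∈ (Q ν).filter (fun S => ν ∈ S (l + 1)), E S) ≤
        2 * (2 : ℝ≥0∞)⁻¹ ^ K * (2 : ℝ≥0∞)⁻¹ ^ (ν - x l) := by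
    intro l ν hν
    have hνn : ν < n := Finset.mem_range.1 (hP _ (Finset.mem_inter.1 hν).1)
    obtain ⟨hxν, hcard⟩ := hx l ν hν
    set c := ∑ k, ((P k).filter (ν ≤ ·)).card with hcdef
    calc volume (⋃ S ∈ (Q ν).filter (fun S => ν ∈ S (l + 1)), E S)
        ≤ ∑ S ∈ (Q ν).filter (fun S => ν ∈ S (l + 1)), volume (E S) :=
          measure_biUnion_finset_le _ _
      _ ≤ ∑ S ∈ (Q ν).filter (fun S => ν ∈ S (l + 1)), (2 : ℝ≥0∞)⁻¹ ^ (n - 1 - ν) := by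
          refine Finset.sum_le_sum fun S hS => ?_
          obtain ⟨hS1, hS2⟩ := Finset.mem_filter.1 hS
          refine volume_combination_eq_zero_le S (l + 1) hS2 (fun j hj => ?_) hνn
          exact (Finset.mem_filter.1 (Finset.mem_powerset.1
            (Fintype.mem_piFinset.1 hS1 (l + 1)) hj)).2
      _ ≤ (2 : ℝ≥0∞) ^ c * (2 : ℝ≥0∞)⁻¹ ^ (n - 1 - ν) := by
          rw [Finset.sum_const, nsmul_eq_mul]
          gcongr
          have h1 : (Q ν).card = 2 ^ c := by
            simp only [Q, Fintype.card_piFinset, Finset.card_powerset]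
            rw [Finset.prod_pow_eq_pow_sum]
          have h2 : ((Q ν).filter (fun S => ν ∈ S (l + 1))).card ≤ 2 ^ c :=
            h1 ▸ Finset.card_filter_le _ _
          exact_mod_cast h2
      -- The digit that is always one costs a factor 2. The geometric sum gives another 2 and the
      -- choice of `l` a 3, whence 12.
      _ = (2 : ℝ≥0∞) ^ (c + 1) * (2 : ℝ≥0∞)⁻¹ ^ (n - ν) := by
          have : n - ν = n - 1 - ν + 1 := by omega
          rw [this, pow_succ, pow_succ]
          calc _ = (2 : ℝ≥0∞) ^ c * (2 : ℝ≥0∞)⁻¹ ^ (n - 1 - ν) * (2 * 2⁻¹) := by rw [hc, mul_one]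
            _ = _ := by ring
      _ ≤ (2 : ℝ≥0∞) ^ (c + 1) * (2 : ℝ≥0∞)⁻¹ ^ (c + K + (ν - x l)) := by
          exact mul_le_mul_right (pow_le_pow_right_of_le_one' (by simp) hcard) _
      _ = (2 * 2⁻¹) ^ c * (2 * (2 : ℝ≥0∞)⁻¹ ^ K * (2 : ℝ≥0∞)⁻¹ ^ (ν - x l)) := by
          rw [mul_pow]; ring
      _ = _ := by rw [hc, one_pow, one_mul]
  calc _ ≤ _ := measure_mono hsub
    _ ≤ ∑ l : Fin 3, ∑ ν ∈ P (l + 1) ∩ P (l + 2),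
          2 * (2 : ℝ≥0∞)⁻¹ ^ K * (2 : ℝ≥0∞)⁻¹ ^ (ν - x l) := by
        refine (measure_iUnion_fintype_le _ _).trans (Finset.sum_le_sum fun l _ => ?_)
        exact (measure_biUnion_finset_le _ _).trans (Finset.sum_le_sum fun ν hν => hterm l ν hν)
    _ ≤ ∑ l : Fin 3, 2 * (2 : ℝ≥0∞)⁻¹ ^ K * 2 := by
        refine Finset.sum_le_sum fun l _ => ?_
        rw [← Finset.mul_sum]
        gcongr
        exact sum_geometric_le _ _ fun ν hν => (hx l ν hν).1
    _ = 12 * (2 : ℝ≥0∞)⁻¹ ^ K := by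
        rw [Finset.sum_const, Finset.card_univ, Fintype.card_fin, nsmul_eq_mul]
        push_cast
        ring

theorem volume_exists_not_resolvable_le (K : ℕ) (n : Fin 2 → ℕ) (P : Fin 2 → Fin 3 → Finset ℕ)
    (hP : ∀ m k, P m k ⊆ Finset.range (n m)) (x : Fin 2 → Fin 3 → ℕ)
    (hx : ∀ m l, ∀ ν ∈ P m (l + 1) ∩ P m (l + 2), x m l ≤ ν ∧
      (∑ k, ((P m k).filter (ν ≤ ·)).card) + K + (ν - x m l) ≤ n m - ν) :
    volume {g ∈ gainBox | ∃ m, ¬ Resolvable (n m) (P m) (g m)} ≤ 24 * (2 : ℝ≥0∞)⁻¹ ^ K := by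
  let C : Set (Fin 3 → ℝ) := Set.univ.pi fun _ => Set.Ioc (1 : ℝ) 2
  let A : Fin 2 → Set (Fin 3 → ℝ) := fun m =>
    {g | (∀ k, g k ∈ Set.Ioc (1 : ℝ) 2) ∧ ¬ Resolvable (n m) (P m) g}
  have hC : volume C = 1 := by
    simp only [C]
    rw [volume_pi_pi]
    simp [Real.volume_Ioc]
    norm_num
  have hA : ∀ m, volume (A m) ≤ 12 * (2 : ℝ≥0∞)⁻¹ ^ K := fun m =>
    volume_not_resolvable_le (n m) K (P m) (hP m) (x m) (hx m)
  have hsub : {g ∈ gainBox | ∃ m, ¬ Resolvable (n m) (P m) (g m)} ⊆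
      ⋃ m : Fin 2, Set.univ.pi fun m' => if m' = m then A m else C := by
    rintro g ⟨hg, m, hm⟩
    refine Set.mem_iUnion.2 ⟨m, fun m' _ => ?_⟩
    by_cases h : m' = m
    · subst h
      simp only [if_true]
      exact ⟨fun k => hg _ k, hm⟩
    · simp only [h, if_false]
      exact fun k _ => hg _ k
  refine (measure_mono hsub).trans ((measure_iUnion_fintype_le _ _).trans ?_)
  calc _ ≤ ∑ m : Fin 2, 12 * (2 : ℝ≥0∞)⁻¹ ^ K := by
        refine Finset.sum_le_sum fun m _ => ?_
        rw [volume_pi_pi]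
        refine le_trans (le_of_eq ?_) (hA m)
        rw [Fin.prod_univ_two]
        fin_cases m <;> simp [hC]
    _ = _ := by
        rw [Finset.sum_const, Finset.card_univ, Fintype.card_fin, nsmul_eq_mul]
        push_cast
        ring

end Gains

/-! ### Uncoded transmission on resolvable bit allocations -/

section LinearCode

open PowerSeries

/-- The positions of the nonzero bits of `v`. -/
def bitSupport {n : ℕ} (v : Fin n → ZMod 2) : Finset ℕ :=
  (Finset.univ.filter fun i => v i ≠ 0).image Fin.val

theorem val_mem_bitSupport {n : ℕ} {v : Fin n → ZMod 2} {i : Fin n} :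
    (i : ℕ) ∈ bitSupport v ↔ v i ≠ 0 := by
  simp only [bitSupport, Finset.mem_image, Finset.mem_filter, Finset.mem_univ, true_and]
  constructor
  · rintro ⟨j, hj, h⟩
    rwa [← Fin.ext h]
  · intro h
    exact ⟨i, h, rfl⟩

theorem lt_of_mem_bitSupport {n : ℕ} {v : Fin n → ZMod 2} {j : ℕ} (hj : j ∈ bitSupport v) :
    j < n := by
  simp only [bitSupport, Finset.mem_image] at hj
  obtain ⟨i, -, rfl⟩ := hj
  exact i.2

theorem coeff_indSeries_bitSupport {n : ℕ} (v : Fin n → ZMod 2) (i : Fin n) :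
    coeff i (indSeries (bitSupport v)) = v i := by
  have h : ∀ z : ZMod 2, (if z ≠ 0 then (1 : ZMod 2) else 0) = z := by decide
  simp only [indSeries, coeff_mk, val_mem_bitSupport, h]

theorem toeplitz_mulVec_eq_coeff {n : ℕ} {x : ℝ} (hx : x ∈ Set.Ioc (1 : ℝ) 2)
    (v : Fin n → ZMod 2) (i : Fin n) :
    (toeplitz n x).mulVec v i = coeff i (gainSeries x * indSeries (bitSupport v)) := by
  have h1 : (toeplitz n x).mulVec v i = ∑ k : Fin n, (fun k : ℕ => if k ≤ i then
      coeff k (indSeries (bitSupport v)) * coeff (i - k) (gainSeries x) else 0) k := by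
    simp only [Matrix.mulVec, dotProduct, coeff_indSeries_bitSupport]
    refine Finset.sum_congr rfl fun k _ => ?_
    rcases lt_trichotomy k i with h | h | h
    · simp [toeplitz, h.ne, h, h.le, gainSeries, mul_comm]
    · simp [toeplitz, h, gainSeries, binDigit_zero hx]
    · simp [toeplitz, h.ne', h.not_gt, h.not_ge]
  refine h1.trans ((Fin.sum_univ_eq_sum_range (fun k : ℕ => if k ≤ i then
    coeff k (indSeries (bitSupport v)) * coeff (i - k) (gainSeries x) else 0) n).trans ?_)
  rw [mul_comm (gainSeries x), coeff_mul,
    Finset.Nat.sum_antidiagonal_eq_sum_range_succ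
      (fun k l => coeff k (indSeries (bitSupport v)) * coeff l (gainSeries x)),
    ← Finset.sum_filter]
  refine Finset.sum_congr ?_ fun _ _ => rfl
  ext k
  have := i.2
  simp only [Finset.mem_filter, Finset.mem_range]
  omega

variable {N : Fin 2 → Fin 2 → ℕ} {g : Fin 2 → Fin 3 → ℝ}

theorem seen_sub (m k : Fin 2) (u u' : Fin (N k k) → ZMod 2) :
    seen N m k (u - u') = seen N m k u - seen N m k u' := by
  funext i
  simp only [seen, Pi.sub_apply]
  split_ifs
  · rfl
  · rw [sub_zero]

theorem output_sub (u u' : (a k : Fin 2) → Fin (N k k) → ZMod 2) (m : Fin 2) :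
    output N g (fun a k => u a k - u' a k) m = output N g u m - output N g u' m := by
  simp only [output, seen_sub]
  simp only [Matrix.mulVec_sub, Matrix.mulVec_add]
  abel

theorem mem_of_mem_bitSupport_seen {m k : Fin 2} {u : Fin (N k k) → ZMod 2} {A P : Finset ℕ}
    (hN : N m k ≤ N m m) (hu : ∀ i, u i ≠ 0 → (i : ℕ) ∈ A)
    (hP : ∀ j ∈ A, j < N m k → N m m - N m k + j ∈ P) (i : Fin (N m m))
    (hi : seen N m k u i ≠ 0) : (i : ℕ) ∈ P := by
  unfold seen at hi
  split_ifs at hi with h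
  · have h1 := hP _ (hu _ hi) (by
      have := i.2
      simp only
      omega)
    simp only at h1
    rwa [Nat.add_sub_cancel' h.1] at h1
  · exact absurd rfl hi

/-- The bit positions `A m k` used by the signal from transmitter `k` with the message for receiver
`m` are seen at receiver `m` at the positions `P m`. -/
structure BitAllocation (N : Fin 2 → Fin 2 → ℕ) (A : Fin 2 → Fin 2 → Finset ℕ)
    (P : Fin 2 → Fin 3 → Finset ℕ) : Prop where
  lt : ∀ m k, ∀ j ∈ A m k, j < N m k
  desired : ∀ m k, ∀ j ∈ A m k, N m m - N m k + j ∈ P m k.succ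
  interference : ∀ m k, ∀ j ∈ A m.rev k, j < N m k → N m m - N m k + j ∈ P m 0

/-- The output is a `combination` of three supports, the interfering signals entering only through
their sum; resolvability empties all three. The interfering signals need not vanish separately. -/
theorem eq_zero_of_output_eq_zero {A : Fin 2 → Fin 2 → Finset ℕ} {P : Fin 2 → Fin 3 → Finset ℕ}
    (hN : ∀ m k, N m k ≤ N m m) (hA : BitAllocation N A P) (hg : g ∈ gainBox)
    (m : Fin 2) (hr : Resolvable (N m m) (P m) (g m))
    {u : (a k : Fin 2) → Fin (N k k) → ZMod 2} (hu : ∀ a k i, u a k i ≠ 0 → (i : ℕ) ∈ A a k)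
    (h0 : output N g u m = 0) (k : Fin 2) : u m k = 0 := by
  have h1 := hr ![bitSupport (seen N m 0 (u m.rev 0) + seen N m 1 (u m.rev 1)),
    bitSupport (seen N m 0 (u m 0)), bitSupport (seen N m 1 (u m 1))] (by
      intro l j hj
      fin_cases l
      · have hj' : j ∈ bitSupport (seen N m 0 (u m.rev 0) + seen N m 1 (u m.rev 1)) := hj
        lift j to Fin (N m m) using lt_of_mem_bitSupport hj'
        rw [val_mem_bitSupport, Pi.add_apply] at hj'
        by_cases hz : seen N m 0 (u m.rev 0) j = 0
        · rw [hz, zero_add] at hj'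
          exact mem_of_mem_bitSupport_seen (hN m 1) (hu m.rev 1) (hA.interference m 1) j hj'
        · exact mem_of_mem_bitSupport_seen (hN m 0) (hu m.rev 0) (hA.interference m 0) j hz
      · have hj' : j ∈ bitSupport (seen N m 0 (u m 0)) := hj
        lift j to Fin (N m m) using lt_of_mem_bitSupport hj'
        exact mem_of_mem_bitSupport_seen (hN m 0) (hu m 0) (fun j hj _ => hA.desired m 0 j hj) j
          (val_mem_bitSupport.1 hj')
      · have hj' : j ∈ bitSupport (seen N m 1 (u m 1)) := hj
        lift j to Fin (N m m) using lt_of_mem_bitSupport hj'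
        exact mem_of_mem_bitSupport_seen (hN m 1) (hu m 1) (fun j hj _ => hA.desired m 1 j hj) j
          (val_mem_bitSupport.1 hj')) (by
      intro i hi
      have h2 := congrFun h0 ⟨i, hi⟩
      simp only [output, Pi.add_apply, toeplitz_mulVec_eq_coeff (hg m _), Pi.zero_apply] at h2
      rw [combination, Fin.sum_univ_three, map_add, map_add, add_assoc, add_comm]
      exact h2)
  have h3 : seen N m k (u m k) = 0 := by
    have key : bitSupport (seen N m k (u m k)) = ∅ := by
      fin_cases k
      · exact h1 1
      · exact h1 2
    funext i
    by_contra hi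
    have := val_mem_bitSupport.2 hi
    rw [key] at this
    exact absurd this (Finset.notMem_empty _)
  funext i
  by_contra hi
  have h4 : seen N m k (u m k) = seen N m k 0 := by
    rw [h3]
    funext i
    simp [seen]
  exact hi (eq_of_seen_eq (hN m k) h4 i (hA.lt m k i (hu m k i hi)))

/-- By linearity, two inputs with equal outputs differ by an input with zero output, so the desired
bits are recovered without error at every block length. -/
theorem achievable_of_resolvable {A : Fin 2 → Fin 2 → Finset ℕ} {P : Fin 2 → Fin 3 → Finset ℕ}
    (hN : ∀ m k, N m k ≤ N m m) (hN' : ∀ m k, N m k ≤ N k k) (hA : BitAllocation N A P)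
    (hg : g ∈ gainBox) (hr : ∀ m, Resolvable (N m m) (P m) (g m)) :
    Achievable N g fun m k => ((A m k).card : ℝ) := by
  classical
  refine ⟨fun m k => Nat.cast_nonneg _, fun ε hε => ⟨0, fun T _ => ?_⟩⟩
  let M : Fin 2 → Fin 2 → ℕ := fun m k => Fintype.card (Fin T → A m k → ZMod 2)
  let e : (m k : Fin 2) → Fin (M m k) ≃ (Fin T → A m k → ZMod 2) := fun m k =>
    (Fintype.equivFin _).symm
  let enc : (m k : Fin 2) → Fin (M m k) → Fin T → Fin (N k k) → ZMod 2 := fun m k w t i =>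
    if h : (i : ℕ) ∈ A m k then e m k w t ⟨i, h⟩ else 0
  let rec' : ((m k : Fin 2) → Fin (M m k)) → (m : Fin 2) → Fin T → Fin (N m m) → ZMod 2 :=
    fun w m t => output N g (fun a k => enc a k (w a k) t) m
  have M_pos : ∀ m k, 0 < M m k := fun m k => Fintype.card_pos
  have inj : ∀ w w' m, rec' w m = rec' w' m → ∀ k, w m k = w' m k := by
    intro w w' m h k
    apply (e m k).injective
    funext t ⟨j, hj⟩
    have h1 := eq_zero_of_output_eq_zero hN hA hg m (hr m)
      (u := fun a k => enc a k (w a k) t - enc a k (w' a k) t)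
      (fun a k i hi => by
        by_contra hc
        exact hi (by simp [enc, hc]))
      (by rw [output_sub (fun a k => enc a k (w a k) t) (fun a k => enc a k (w' a k) t), sub_eq_zero]
          exact congrFun h t) k
    have h2 := congrFun h1 ⟨j, (hA.lt m k j hj).trans_le (hN' m k)⟩
    simpa [enc, hj, sub_eq_zero] using h2
  let dec : (m k : Fin 2) → (Fin T → Fin (N m m) → ZMod 2) → Fin (M m k) := fun m k y =>
    if h : ∃ w, rec' w m = y then h.choose m k else ⟨0, M_pos m k⟩
  refine ⟨M, ⟨enc, dec⟩, fun m k => ?_, ?_⟩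
  · have : M m k = 2 ^ (T * (A m k).card) := by
      simp only [M, Fintype.card_fun, ZMod.card, Fintype.card_fin, Fintype.card_coe]
      rw [← pow_mul, mul_comm]
    rw [this, ← Nat.cast_mul, Real.rpow_natCast]
    push_cast
    exact le_rfl
  · have : {w : (m k : Fin 2) → Fin (M m k) | ∃ m k, (Code.mk enc dec).dec m k
        ((Code.mk enc dec).received g w m) ≠ w m k} = ∅ := by
      refine Set.eq_empty_iff_forall_notMem.2 ?_
      rintro w ⟨m, k, hw⟩
      apply hw
      have h : ∃ w', rec' w' m = rec' w m := ⟨w, rfl⟩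
      change dec m k (rec' w m) = w m k
      simp only [dec, h, dif_pos]
      exact inj _ _ m h.choose_spec k
    rw [Code.errorProb, this, Set.ncard_empty, Nat.cast_zero, zero_div]
    exact hε.le

end LinearCode

/-! ### Choice of the levels and the resulting rate -/

section Allocation

/-- Suppose a receiver, at its first `L` levels, sees desired bits from its own transmitter at the
levels `[0, α)`, interference at the levels `[s, s + μ)` and desired bits from the other transmitter
at the levels `[s + s', s + s' + α')`.  These lengths fit if all these bits lie in the first `L`
levels and no more bits than levels remain from the start of each collision on. -/
def Fits (L s s' α μ α' : ℕ) : Prop :=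
  α ≤ L ∧ (0 < μ → s + μ ≤ L) ∧
    (0 < α' → s + s' + α' + (α - (s + s')) + (μ - s') ≤ L) ∧
    (s < α → 0 < μ → α + μ + α' ≤ L)

theorem card_filter_Ico (x y ν : ℕ) : ((Finset.Ico x y).filter (ν ≤ ·)).card = y - max x ν := by
  rw [← Nat.card_Ico]
  congr 1
  ext j
  simp only [Finset.mem_filter, Finset.mem_Ico, sup_le_iff]
  omega

theorem card_filter_union_le (α q n ν : ℕ) (hν : ν < q) :
    ((Finset.Ico 0 α ∪ Finset.Ico q n).filter (ν ≤ ·)).card ≤ (α - ν) + (n - q) := by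
  rw [Finset.filter_union]
  refine (Finset.card_union_le _ _).trans ?_
  rw [card_filter_Ico, card_filter_Ico]
  omega

/-- At the start of a run of collisions this is `Fits`, the private levels from `q` to `n` adding
equally to bits and levels. Each further level of the run removes at least two bits but one level,
so the slack grows by at least one. -/
theorem Fits.slack {n q K s s' α μ α' : ℕ} (h : Fits (q - K) s s' α μ α') (hq : q ≤ n) (ν : ℕ)
    {c : ℕ}
    (hc : c = ((Finset.Ico 0 α ∪ Finset.Ico q n).filter (ν ≤ ·)).card +
      ((Finset.Ico s (s + μ)).filter (ν ≤ ·)).card +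
      ((Finset.Ico (s + s') (s + s' + α')).filter (ν ≤ ·)).card) :
    let own := Finset.Ico 0 α ∪ Finset.Ico q n
    let int := Finset.Ico s (s + μ)
    let cross := Finset.Ico (s + s') (s + s' + α')
    (ν ∈ own → ν ∈ int → s ≤ ν ∧ c + K + (ν - s) ≤ n - ν) ∧
    (ν ∈ own → ν ∈ cross → s + s' ≤ ν ∧ c + K + (ν - (s + s')) ≤ n - ν) ∧
    (ν ∈ int → ν ∈ cross → s + s' ≤ ν ∧ c + K + (ν - (s + s')) ≤ n - ν) := by
  obtain ⟨h1, h2, h3, h4⟩ := h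
  have key := card_filter_union_le α q n ν
  simp only [card_filter_Ico] at hc
  subst hc
  simp only [Finset.mem_union, Finset.mem_Ico]
  generalize ((Finset.Ico 0 α ∪ Finset.Ico q n).filter (ν ≤ ·)).card = w at key ⊢
  refine ⟨fun ho hi => ?_, fun ho hc => ?_, fun hi hc => ?_⟩
  · have i1 := h2 (by omega)
    have i2 : α + μ + α' ≤ q - K := h4 (by omega) (by omega)
    have i3 := key (by omega)
    have i4 : s + s' + α' - max (s + s') ν ≤ α' := by omega
    rw [max_eq_right hi.1]
    clear h2 h3 h4 key
    generalize s + s' + α' - max (s + s') ν = y at i4 ⊢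
    omega
  · have i1 := h3 (by omega)
    have i2 := key (by omega)
    rw [max_eq_right hc.1, max_eq_right ((Nat.le_add_right s s').trans hc.1)]
    clear h2 h3 h4 key
    omega
  · have i1 := h3 (by omega)
    have i2 := h2 (by omega)
    have i3 := key (by omega)
    rw [max_eq_right hc.1, max_eq_right hi.1]
    clear h2 h3 h4 key
    omega

/-- The four cases are the regimes in which D₁, D₂, D₃, D₄ are reached. The additive 1 and 8 are the
losses from integer division. -/
theorem exists_lengths_of_le {s s' L L' : ℕ} (h1 : L ≤ s + L') (h2 : L' ≤ s' + L) :
    ∃ α α' β γ, Fits L s s' α (max β γ) α' ∧ Fits L' s' s γ (max α α') β ∧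
      ((L - s) + (L' - s') ≤ α + α' + β + γ ∨
        L + L' + (L' - s') ≤ 2 * (α + α' + β + γ) + 1 ∨
        L + L' + (L - s) ≤ 2 * (α + α' + β + γ) + 1 ∨
        2 * (L + L') ≤ 3 * (α + α' + β + γ) + 8) := by
  obtain ⟨r, hr⟩ : ∃ r, r = L - s := ⟨_, rfl⟩
  obtain ⟨r', hr'⟩ : ∃ r', r' = L' - s' := ⟨_, rfl⟩
  by_cases c1 : r ≤ s + s' ∧ r' ≤ s + s'
  · refine ⟨min s r', r - s', r' - s, min s' r, ?_, ?_, Or.inl ?_⟩ <;> (try unfold Fits) <;> omega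
  by_cases c2 : s + s' ≤ r ∧ 2 * r' ≤ r + (s + s')
  -- Here α = α' and max β γ = s', with α + α' + s' filling the `L` levels of the first receiver up
  -- to rounding.
  · refine ⟨(r + s - s') / 2, (r + s - s') / 2, r' - (r + s - s') / 2, s', ?_, ?_,
      Or.inr (Or.inl ?_)⟩ <;> (try unfold Fits) <;> omega
  by_cases c3 : s + s' ≤ r' ∧ 2 * r ≤ r' + (s + s')
  · refine ⟨s, r - (r' + s' - s) / 2, (r' + s' - s) / 2, (r' + s' - s) / 2, ?_, ?_,
      Or.inr (Or.inr (Or.inl ?_))⟩ <;> (try unfold Fits) <;> omega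
  -- Up to rounding, α = α' and β = γ solve 2α + β = L and α + 2β = L', both receivers being full.
  · refine ⟨(2 * r + 2 * s - r' - s') / 3, (2 * r + 2 * s - r' - s') / 3,
      (2 * r' + 2 * s' - r - s) / 3, (2 * r' + 2 * s' - r - s) / 3, ?_, ?_,
      Or.inr (Or.inr (Or.inr ?_))⟩ <;> (try unfold Fits) <;> omega

theorem exists_lengths (a b p q K : ℕ) (hpa : p ≤ a) (hpb : p ≤ b) (hqa : q ≤ a) (hqb : q ≤ b) :
    ∃ α α' β γ, Fits (q - K) (a - p) (b - q) α (max β γ) α' ∧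
      Fits (p - K) (b - q) (a - p) γ (max α α') β ∧
      ((p + q - a) + (p + q - b) ≤ α + α' + β + γ + 2 * K ∨
        p + q + (p + q - b) ≤ 2 * (α + α' + β + γ) + 4 * K + 6 ∨
        p + q + (p + q - a) ≤ 2 * (α + α' + β + γ) + 4 * K + 6 ∨
        2 * (p + q) ≤ 3 * (α + α' + β + γ) + 6 * K + 9) := by
  by_cases hK : p < K ∨ q < K
  -- If a cross link is shorter than the guard, D₁ is at most 2K and private bits alone suffice.
  · refine ⟨0, 0, 0, 0, ?_, ?_, Or.inl ?_⟩
    · simp [Fits]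
    · simp [Fits]
    · omega
  · obtain ⟨α, α', β, γ, h1, h2, h3⟩ := exists_lengths_of_le (s := a - p) (s' := b - q)
      (L := q - K) (L' := p - K) (by omega) (by omega)
    refine ⟨α, α', β, γ, h1, h2, ?_⟩
    omega

theorem D_le (N : Fin 2 → Fin 2 → ℕ) {t K : ℕ}
    (hN : max (N 0 1) (N 1 0) ≤ min (N 0 0) (N 1 1))
    (h : (N 0 1 + N 1 0 - N 0 0) + (N 0 1 + N 1 0 - N 1 1) ≤ t + 2 * K ∨
      N 0 1 + N 1 0 + (N 0 1 + N 1 0 - N 1 1) ≤ 2 * t + 4 * K + 6 ∨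
      N 0 1 + N 1 0 + (N 0 1 + N 1 0 - N 0 0) ≤ 2 * t + 4 * K + 6 ∨
      2 * (N 0 1 + N 1 0) ≤ 3 * t + 6 * K + 9) :
    D N ≤ ((t + (N 0 0 - N 1 0) + (N 1 1 - N 0 1) : ℕ) : ℝ) + 2 * K + 3 := by
  simp only [max_le_iff, le_min_iff] at hN
  obtain ⟨⟨hpa, hqa⟩, hpb, hqb⟩ := hN
  have key : ∀ n : ℕ, max ((N 0 1 : ℝ) + N 1 0 - n) 0 = ((N 0 1 + N 1 0 - n : ℕ) : ℝ) := by
    intro n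
    rcases le_total (N 0 1 + N 1 0) n with hn | hn
    · rw [Nat.sub_eq_zero_of_le hn, max_eq_right]
      · simp
      · have : ((N 0 1 + N 1 0 : ℕ) : ℝ) ≤ n := by exact_mod_cast hn
        push_cast at this
        linarith
    · rw [Nat.cast_sub hn, max_eq_left]
      · push_cast; ring
      · have : (n : ℝ) ≤ ((N 0 1 + N 1 0 : ℕ) : ℝ) := by exact_mod_cast hn
        push_cast at this
        linarith
  rw [D, Nat.cast_add, Nat.cast_add, Nat.cast_sub hqa, Nat.cast_sub hpb]
  suffices H : min (min (D1 N) (D2 N)) (min (D3 N) (D4 N)) ≤ (t : ℝ) + 2 * K + 3 by linarith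
  simp only [min_le_iff, D1, D2, D3, D4, key]
  rcases h with h | h | h | h
  · have h' : (((N 0 1 + N 1 0 - N 0 0 : ℕ) : ℝ)) + ((N 0 1 + N 1 0 - N 1 1 : ℕ) : ℝ) ≤
      t + 2 * K := by exact_mod_cast h
    exact Or.inl (Or.inl (by linarith))
  · have h' : (N 0 1 : ℝ) + N 1 0 + ((N 0 1 + N 1 0 - N 1 1 : ℕ) : ℝ) ≤
      2 * t + 4 * K + 6 := by exact_mod_cast h
    exact Or.inl (Or.inr (by linarith))
  · have h' : (N 0 1 : ℝ) + N 1 0 + ((N 0 1 + N 1 0 - N 0 0 : ℕ) : ℝ) ≤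
      2 * t + 4 * K + 6 := by exact_mod_cast h
    exact Or.inr (Or.inl (by linarith))
  · have h' : 2 * ((N 0 1 : ℝ) + N 1 0) ≤ 3 * t + 6 * K + 9 := by exact_mod_cast h
    exact Or.inr (Or.inr (by linarith))

open MeasureTheory in
open scoped ENNReal in
-- Private bits invisible at the other receiver fill the bottom of each direct signal. Each cross
-- signal starts at level `s` or `s'`, exactly where the other undesired signal first appears at the
-- unintended receiver, so interference occupies only the longer of the two lengths.
theorem exists_exceptional_set (N : Fin 2 → Fin 2 → ℕ) (K : ℕ)
    (hN : max (N 0 1) (N 1 0) ≤ min (N 0 0) (N 1 1)) :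
    ∃ E : Set (Fin 2 → Fin 3 → ℝ), volume E ≤ 24 * (2 : ℝ≥0∞)⁻¹ ^ K ∧
      ∀ g ∈ gainBox \ E, ∃ R : Fin 2 → Fin 2 → ℝ, Achievable N g R ∧
        D N - (2 * K + 3) ≤ ∑ m, ∑ k, R m k := by
  have hN' := hN
  simp only [max_le_iff, le_min_iff] at hN'
  obtain ⟨⟨hpa, hqa⟩, hpb, hqb⟩ := hN'
  obtain ⟨α, α', β, γ, hF, hF', hrate⟩ := exists_lengths (N 0 0) (N 1 1) (N 0 1) (N 1 0) K
    hpa hpb hqa hqb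
  have hD := D_le N hN hrate
  obtain ⟨s, hs⟩ : ∃ s, s = N 0 0 - N 0 1 := ⟨_, rfl⟩
  obtain ⟨s', hs'⟩ : ∃ s', s' = N 1 1 - N 1 0 := ⟨_, rfl⟩
  rw [← hs, ← hs'] at hF hF'
  let own : Finset ℕ := Finset.Ico 0 α ∪ Finset.Ico (N 1 0) (N 0 0)
  let own' : Finset ℕ := Finset.Ico 0 γ ∪ Finset.Ico (N 0 1) (N 1 1)
  let P : Fin 2 → Fin 3 → Finset ℕ :=
    ![![Finset.Ico s (s + max β γ), own, Finset.Ico (s + s') (s + s' + α')],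
      ![Finset.Ico s' (s' + max α α'), Finset.Ico (s' + s) (s' + s + β), own']]
  let A : Fin 2 → Fin 2 → Finset ℕ :=
    ![![own, Finset.Ico s' (s' + α')], ![Finset.Ico s (s + β), own']]
  -- The level at which the two patterns other than `l` can first collide.
  let x : Fin 2 → Fin 3 → ℕ := ![![s + s', s + s', s], ![s' + s, s', s' + s]]
  have e : N 0 0 = s + N 0 1 := by clear hrate hD hF hF'; omega
  have e' : N 1 1 = s' + N 1 0 := by clear hrate hD hF hF'; omega
  have f1 : α ≤ N 1 0 := hF.1.trans (Nat.sub_le _ _)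
  have f1' : γ ≤ N 0 1 := hF'.1.trans (Nat.sub_le _ _)
  have f2 : max β γ = 0 ∨ s + max β γ ≤ N 1 0 := by
    have := hF.2.1; clear hrate hD hF hF'; omega
  have f2' : max α α' = 0 ∨ s' + max α α' ≤ N 0 1 := by
    have := hF'.2.1; clear hrate hD hF hF'; omega
  have f3 : α' = 0 ∨ s + s' + α' ≤ N 1 0 := by
    have := hF.2.2.1; clear hrate hD hF hF'; omega
  have f3' : β = 0 ∨ s' + s + β ≤ N 0 1 := by
    have := hF'.2.2.1; clear hrate hD hF hF'; omega
  have hP : ∀ m k, P m k ⊆ Finset.range (N m m) := by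
    intro m k j hj
    rw [Finset.mem_range]
    clear hrate hD hF hF' hN
    fin_cases m <;> fin_cases k <;> simp [P, own, own'] at hj ⊢ <;> omega
  have hx : ∀ m l, ∀ ν ∈ P m (l + 1) ∩ P m (l + 2), x m l ≤ ν ∧
      (∑ k, ((P m k).filter (ν ≤ ·)).card) + K + (ν - x m l) ≤ N m m - ν := by
    intro m l ν hν
    obtain ⟨h1, h2⟩ := Finset.mem_inter.1 hν
    fin_cases m
    · have hc : ∑ k, ((P 0 k).filter (ν ≤ ·)).card = _ := (Fin.sum_univ_three _).trans
        ((by intros; ring : ∀ a b c : ℕ, a + b + c = b + a + c) _ _ _)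
      obtain ⟨u1, u2, u3⟩ := hF.slack hqa ν hc
      fin_cases l
      exacts [u2 h1 h2, u3 h2 h1, u1 h2 h1]
    · have hc : ∑ k, ((P 1 k).filter (ν ≤ ·)).card = _ := (Fin.sum_univ_three _).trans
        ((by intros; ring : ∀ a b c : ℕ, a + b + c = c + a + b) _ _ _)
      obtain ⟨u1, u2, u3⟩ := hF'.slack hpb ν hc
      fin_cases l
      exacts [u2 h2 h1, u1 h1 h2, u3 h1 h2]
  have hA : BitAllocation N A P := by
    clear hrate hD hF hF' hN hx hP
    constructor
    · intro m k j hj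
      fin_cases m <;> fin_cases k <;> simp [A, own, own'] at hj ⊢ <;> omega
    · intro m k j hj
      fin_cases m <;> fin_cases k <;> simp [A, P, own, own'] at hj ⊢ <;> omega
    · intro m k j hj hjN
      fin_cases m <;> fin_cases k <;> simp [A, P, own, own'] at hj hjN ⊢ <;> omega
  refine ⟨_, volume_exists_not_resolvable_le K (fun m => N m m) P hP x hx, ?_⟩
  rintro g ⟨hg, hgE⟩
  have hr : ∀ m, Resolvable (N m m) (P m) (g m) := by
    by_contra hc
    exact hgE ⟨hg, not_forall.1 hc⟩
  refine ⟨_, achievable_of_resolvable ?_ ?_ hA hg hr, ?_⟩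
  · intro m k
    fin_cases m <;> fin_cases k
    exacts [le_rfl, hpa, hqb, le_rfl]
  · intro m k
    fin_cases m <;> fin_cases k
    exacts [le_rfl, hpb, hqa, le_rfl]
  · have c1 : own.card = α + (N 0 0 - N 1 0) := by
      rw [Finset.card_union_of_disjoint, Nat.card_Ico, Nat.card_Ico, Nat.sub_zero]
      exact Finset.disjoint_left.2 fun j h1 h2 => by
        rw [Finset.mem_Ico] at h1 h2; omega
    have c2 : own'.card = γ + (N 1 1 - N 0 1) := by
      rw [Finset.card_union_of_disjoint, Nat.card_Ico, Nat.card_Ico, Nat.sub_zero]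
      exact Finset.disjoint_left.2 fun j h1 h2 => by
        rw [Finset.mem_Ico] at h1 h2; omega
    have c3 : ∑ m, ∑ k, ((A m k).card : ℝ) =
        ((α + α' + β + γ + (N 0 0 - N 1 0) + (N 1 1 - N 0 1) : ℕ) : ℝ) := by
      simp only [Fin.sum_univ_two]
      have : A 0 0 = own ∧ A 0 1 = Finset.Ico s' (s' + α') ∧ A 1 0 = Finset.Ico s (s + β) ∧
        A 1 1 = own' := ⟨rfl, rfl, rfl, rfl⟩
      rw [this.1, this.2.1, this.2.2.1, this.2.2.2, c1, c2, Nat.card_Ico, Nat.card_Ico,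
        Nat.add_sub_cancel_left, Nat.add_sub_cancel_left]
      push_cast
      ring
    rw [c3]
    linarith

end Allocation

end XChannel

/-! ### The constant-gap theorem -/

theorem theorem3 :
    ∃ c₁ : ℝ, 0 < c₁ ∧
      ∀ (δ : ℝ) (N : Fin 2 → Fin 2 → ℕ), 0 < δ → δ ≤ 1 →
        max (N 0 1) (N 1 0) ≤ min (N 0 0) (N 1 1) →
        ∃ B : Set (Fin 2 → Fin 3 → ℝ),
          B ⊆ XChannel.gainBox ∧ MeasurableSet B ∧
          MeasureTheory.volume B ≤ ENNReal.ofReal δ ∧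
          ∀ g ∈ XChannel.gainBox \ B,
            ((XChannel.D N - 2 * Real.logb 2 (c₁ / δ) : ℝ) : EReal) ≤ XChannel.sumCapacity N g ∧
            XChannel.sumCapacity N g ≤ ((XChannel.D N : ℝ) : EReal) := by
  -- 192 = 24 · 8: the measure bound needs 2^K ≥ 24/δ, and rounding `K` up makes 2K + 3 less than 2
  -- log(24/δ) + 5, below 2 log(24/δ) + 2 log 8.
  refine ⟨192, by norm_num, fun δ N hδ hδ1 hN => ?_⟩
  have h24 : 1 ≤ 24 / δ := by rw [le_div_iff₀ hδ]; linarith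
  have hlog0 : 0 ≤ Real.logb 2 (24 / δ) := Real.logb_nonneg (by norm_num) h24
  set K := ⌈Real.logb 2 (24 / δ)⌉₊ with hK
  have hK1 : (K : ℝ) < Real.logb 2 (24 / δ) + 1 := Nat.ceil_lt_add_one hlog0
  have hK2 : 24 / δ ≤ 2 ^ K := by
    rw [← Real.rpow_natCast, ← Real.logb_le_iff_le_rpow (by norm_num) (by positivity)]
    exact Nat.le_ceil _
  have hlog : Real.logb 2 (192 / δ) = Real.logb 2 (24 / δ) + 3 := by
    have : (192 : ℝ) / δ = 24 / δ * 2 ^ (3 : ℝ) := by norm_num; ring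
    rw [this, Real.logb_mul (by positivity) (by positivity), Real.logb_rpow (by norm_num)
      (by norm_num)]
  obtain ⟨E, hE, hach⟩ := XChannel.exists_exceptional_set N K hN
  have hbox : MeasurableSet XChannel.gainBox := by
    have : XChannel.gainBox = Set.univ.pi fun _ : Fin 2 => Set.univ.pi fun _ : Fin 3 =>
        Set.Ioc (1 : ℝ) 2 := by
      ext g
      simp [XChannel.gainBox]
    rw [this]
    exact MeasurableSet.univ_pi fun _ => MeasurableSet.univ_pi fun _ => measurableSet_Ioc
  -- The exceptional set is not known to be measurable, so it is replaced by a measurable hull of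
  -- equal measure.
  refine ⟨MeasureTheory.toMeasurable MeasureTheory.volume E ∩ XChannel.gainBox,
    Set.inter_subset_right,
    (MeasureTheory.measurableSet_toMeasurable _ _).inter hbox, ?_, ?_⟩
  · refine (MeasureTheory.measure_mono Set.inter_subset_left).trans ?_
    rw [MeasureTheory.measure_toMeasurable]
    refine hE.trans ?_
    have h1 : (24 : ENNReal) * 2⁻¹ ^ K = ENNReal.ofReal (24 * (2⁻¹) ^ K) := by
      rw [ENNReal.ofReal_mul (by norm_num), ENNReal.ofReal_pow (by norm_num),
        ENNReal.ofReal_inv_of_pos (by norm_num)]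
      simp
    rw [h1]
    refine ENNReal.ofReal_le_ofReal ?_
    rw [inv_pow, ← div_eq_mul_inv, div_le_iff₀ (by positivity)]
    rwa [div_le_iff₀ hδ, mul_comm] at hK2
  · rintro g ⟨hg, hgB⟩
    refine ⟨?_, XChannel.sumCapacity_le hN⟩
    obtain ⟨R, hR, hsum⟩ := hach g ⟨hg, fun h =>
      hgB ⟨MeasureTheory.subset_toMeasurable _ _ h, hg⟩⟩
    refine le_trans (EReal.coe_le_coe_iff.2 ?_) (le_sSup ⟨R, hR, rfl⟩)
    linarith
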